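/- Let $C$ be a generalized Cartan matrix of size $n$, that is, an integer $n\times n$ matrix with $c_{ii}=2$, $c_{ij}\le 0$ for $i\ne j$, and $c_{ij}=0\Rightarrow c_{ji}=0$. Let $\mathfrak g$ be the Kac–Moody Lie algebra of $C$ over $\mathbb C$: given a realization of $C$, consisting of a complex vector space $\mathfrak h$ of dimension $2n-\operatorname{rank} C$, linearly independent $\alpha_1^\vee,\dots,\alpha_n^\vee\in\mathfrak h$ and linearly independent $\alpha_1,\dots,\alpha_n\in\mathfrak h^*$ with $\alpha_j(\alpha_i^\vee)=c_{ij}$, it is the quotient of the Lie algebra $\tilde{\mathfrak g}$ generated by $\mathfrak h$ and $e_i,f_i$ ($1\le i\le n$) with relations $[h,h']=0$, $[h,e_i]=\alpha_i(h)e_i$, $[h,f_i]=-\alpha_i(h)f_i$, $[e_i,f_j]=\delta_{ij}\alpha_i^\vee$ ($h,h'\in\mathfrak h$), by the largest ideal of $\tilde{\mathfrak g}$ that intersects $\mathfrak h$ trivially. Let $\mathfrak g'=[\mathfrak g,\mathfrak g]$, let $\mathfrak h'=\mathfrak h\cap\mathfrak g'$, let $\mathfrak h''$ be a vector space complement of $\mathfrak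 h'$ in $\mathfrak h$, and let $N^+$ be the sum of the root spaces of the positive roots of $\mathfrak g$. Let $A$ be a finitely generated commutative associative unital $\mathbb C$-algebra, and let $\mathfrak g_A=(\mathfrak g'\otimes A)\oplus\mathfrak h''$ be the Lie algebra with $[X\otimes a,Y\otimes b]=[X,Y]\otimes ab$, $[X\otimes a,h]=[X,h]\otimes a$ and $[h,k]=0$ for $X,Y\in\mathfrak g'$, $a,b\in A$, $h,k\in\mathfrak h''$. The element $x+y$ of $\mathfrak h=\mathfrak h'\oplus\mathfrak h''$ is regarded as the element $x\otimes 1+y$ of $\mathfrak g_A$. Let $\psi:(\mathfrak h'\otimes A)\oplus\mathfrak h''\to\mathbb C$ be a linear map, let $B=(N^+\otimes A)\oplus(\mathfrak h'\otimes A)\oplus\mathfrak h''$, let $\mathbb C(\psi)$ be the one-dimensional $B$-module on which $N^+\otimes A$ acts by $0$ and $(\mathfrak h'\otimes A)\oplus\mathfrak h''$ acts by $\psi$, and let $V(\psi)$ be the unique irreducible quotient of the induced module $M(\psi)=U(\mathfrak g_A)\otimes_{U(B)}\mathbb C(\psi)$. Then all weight spaces $V(\psi)_\mu=\{v\in V(\psi):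 hv=\mu(h)v \text{ for all } h\in\mathfrak h\}$, $\mu\in\mathfrak h^*$, are finite-dimensional if and only if there is an ideal $I$ of $A$ with $\dim_{\mathbb C}A/I<\infty$ such that $\psi(\mathfrak h'\otimes I)=0$. -/

import Mathlib

open scoped TensorProduct

universe uι uH uA

/-- Generalized Cartan matrices: integer matrices with `2` on the diagonal, non-positive entries
off the diagonal, and zeros placed symmetrically. -/
structure IsGeneralizedCartanMatrix {ι : Type uι} (C : Matrix ι ι ℤ) : Prop where
  diag : ∀ i, C i i = 2
  offDiag : ∀ i j, i ≠ j → C i j ≤ 0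
  zero_symm : ∀ i j, C i j = 0 → C j i = 0

/-- A (minimal) realization `(H, Π, Π^∨)` of the square matrix `C` over `ℂ`: linearly independent
simple coroots in `H` and simple roots in the dual of `H`, paired by `C`, with
`dim H = 2 n - rank C`. -/
structure CartanRealization {ι : Type uι} [Fintype ι] (C : Matrix ι ι ℤ)
    (H : Type uH) [AddCommGroup H] [Module ℂ H] where
  coroot : ι → H
  root : ι → Module.Dual ℂ H
  linearIndependent_coroot : LinearIndependent ℂ coroot
  linearIndependent_root : LinearIndependent ℂ root
  root_coroot : ∀ i j, root j (coroot i) = (C i j : ℂ)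
  finiteDimensional : FiniteDimensional ℂ H
  finrank_add_rank :
    Module.finrank ℂ H + (C.map (Int.cast : ℤ → ℂ)).rank = 2 * Fintype.card ι

namespace LieIdeal

variable {L : Type*} [LieRing L] [LieAlgebra ℂ L]

/-- The action of a Lie algebra on one of its ideals by (restrictions of) inner derivations. -/
noncomputable def adDerivation (I : LieIdeal ℂ L) : L →ₗ⁅ℂ⁆ LieDerivation ℂ I I where
  toFun x :=
    { toLinearMap := LieModule.toEnd ℂ L I x
      leibniz' := fun a b => by
        apply Subtype.ext
        change ⁅x, ⁅(a : L), (b : L)⁆⁆ = ⁅(a : L), ⁅x, (b : L)⁆⁆ - ⁅(b : L), ⁅x, (a : L)⁆⁆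
        rw [leibniz_lie x (a : L), ← lie_skew (b : L)]
        abel }
  map_add' x y := by ext; simp
  map_smul' c x := by ext; simp
  map_lie' := by
    intro x y
    ext z
    simp

end LieIdeal

namespace CartanRealization

noncomputable section

variable {ι : Type uι} [Fintype ι] {C : Matrix ι ι ℤ}
  {H : Type uH} [AddCommGroup H] [Module ℂ H]

/-- The generators `e i`, `f i` and `h x`, `x ∈ H`. -/
inductive Gen (ι : Type uι) (H : Type uH) : Type (max uι uH)
  | e : ι → Gen ι H
  | f : ι → Gen ι H
  | h : H → Gen ι H

/-- The generator `e i` of the free Lie algebra. -/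
def genE (H : Type uH) (i : ι) : FreeLieAlgebra ℂ (Gen ι H) := FreeLieAlgebra.of ℂ (Gen.e i)

/-- The generator `f i` of the free Lie algebra. -/
def genF (H : Type uH) (i : ι) : FreeLieAlgebra ℂ (Gen ι H) := FreeLieAlgebra.of ℂ (Gen.f i)

/-- The generator `h x` of the free Lie algebra. -/
def genH (ι : Type uι) (x : H) : FreeLieAlgebra ℂ (Gen ι H) := FreeLieAlgebra.of ℂ (Gen.h x)

/-- The defining relations of the auxiliary Lie algebra of a realization. The first two make
`x ↦ h x` linear. -/
inductive AuxRel (R : CartanRealization C H) : FreeLieAlgebra ℂ (Gen ι H) → Prop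
  | h_add (x y : H) : AuxRel R (genH ι (x + y) - (genH ι x + genH ι y))
  | h_smul (c : ℂ) (x : H) : AuxRel R (genH ι (c • x) - c • genH ι x)
  | h_h (x y : H) : AuxRel R ⁅genH ι x, genH ι y⁆
  | h_e (x : H) (i : ι) : AuxRel R (⁅genH ι x, genE H i⁆ - R.root i x • genE H i)
  | h_f (x : H) (i : ι) : AuxRel R (⁅genH ι x, genF H i⁆ + R.root i x • genF H i)
  | e_f_same (i : ι) : AuxRel R (⁅genE H i, genF H i⁆ - genH ι (R.coroot i))
  | e_f_ne (i j : ι) (hij : i ≠ j) : AuxRel R ⁅genE H i, genF H j⁆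

/-- The ideal generated by the defining relations. -/
def relIdeal (R : CartanRealization C H) : LieIdeal ℂ (FreeLieAlgebra ℂ (Gen ι H)) :=
  LieSubmodule.lieSpan ℂ _ {r | AuxRel R r}

/-- The auxiliary Lie algebra `g̃(C)`. -/
abbrev Aux (R : CartanRealization C H) : Type (max uι uH) :=
  FreeLieAlgebra ℂ (Gen ι H) ⧸ R.relIdeal

/-- The canonical linear map from `H` to the auxiliary Lie algebra. -/
def toAux (R : CartanRealization C H) : H →ₗ[ℂ] R.Aux where
  toFun x := LieSubmodule.Quotient.mk (genH ι x)
  map_add' x y := (Submodule.Quotient.eq _).2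
    (LieSubmodule.subset_lieSpan (AuxRel.h_add (R := R) x y))
  map_smul' c x := (Submodule.Quotient.eq _).2
    (LieSubmodule.subset_lieSpan (AuxRel.h_smul (R := R) c x))

/-- The largest ideal of `g̃(C)` intersecting `H` trivially, as the sum of all such ideals. -/
def radIdeal (R : CartanRealization C H) : LieIdeal ℂ R.Aux :=
  sSup {I | I.toSubmodule ⊓ LinearMap.range R.toAux = ⊥}

/-- The Kac-Moody Lie algebra `g = g(C)`. -/
abbrev KacMoody (R : CartanRealization C H) : Type (max uι uH) :=
  R.Aux ⧸ R.radIdeal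

/-- The canonical linear map from `H` to `g`. -/
def toKacMoody (R : CartanRealization C H) : H →ₗ[ℂ] R.KacMoody :=
  (LieSubmodule.Quotient.mk' R.radIdeal : R.Aux →ₗ[ℂ] R.KacMoody) ∘ₗ R.toAux

/-- The Cartan subalgebra `h` of `g`. -/
def cartan (R : CartanRealization C H) : Submodule ℂ R.KacMoody :=
  LinearMap.range R.toKacMoody

/-- The derived algebra `g' = [g, g]`. -/
def derived (R : CartanRealization C H) : LieIdeal ℂ R.KacMoody :=
  ⁅(⊤ : LieIdeal ℂ R.KacMoody), (⊤ : LieIdeal ℂ R.KacMoody)⁆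

/-- `h' = h ∩ g'`, as a subspace of `g'`. -/
def cartanDerived (R : CartanRealization C H) : Submodule ℂ R.derived :=
  R.cartan.comap R.derived.toSubmodule.subtype

/-- The subspace of all `x ∈ g` with `[h, x] = μ(h) x` for all `h`. -/
def rootSpace (R : CartanRealization C H) (μ : Module.Dual ℂ H) : Submodule ℂ R.KacMoody where
  carrier := {x | ∀ h : H, ⁅R.toKacMoody h, x⁆ = μ h • x}
  zero_mem' h := by simp
  add_mem' {x y} hx hy h := by simp [hx h, hy h]
  smul_mem' c x hx h := by simp [hx h, smul_comm c]

/-- `N⁺`, the sum of the root spaces of all positive roots, as a subspace of `g'`. (For a nonzero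
`n : ι → ℕ` such that `∑ n i • α i` is not a root the summand is zero.) -/
def nPos (R : CartanRealization C H) : Submodule ℂ R.derived :=
  (⨆ n : {n : ι → ℕ // n ≠ 0}, R.rootSpace (∑ i, n.1 i • R.root i)).comap
    R.derived.toSubmodule.subtype

/-- `K = h''` is a vector space complement of `h'` in `h`. (As `h` is abelian, every subspace of
`h` is a Lie subalgebra of `g`.) -/
structure IsComplement (R : CartanRealization C H) (K : LieSubalgebra ℂ R.KacMoody) : Prop where
  disjoint : (R.cartan ⊓ R.derived.toSubmodule) ⊓ K.toSubmodule = ⊥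
  sup_eq : (R.cartan ⊓ R.derived.toSubmodule) ⊔ K.toSubmodule = R.cartan

variable (A : Type uA) [CommRing A] [Algebra ℂ A]

/-- The action of `K = h''` on `A ⊗ g'` by derivations, `y ↦ (a ⊗ x ↦ a ⊗ [y, x])`. -/
def currentAction (R : CartanRealization C H) (K : LieSubalgebra ℂ R.KacMoody) :
    K →ₗ⁅ℂ⁆ LieDerivation ℂ (A ⊗[ℂ] R.derived) (A ⊗[ℂ] R.derived) :=
  ((Lie.Derivation.ofLieDerivation A).comp R.derived.adDerivation).comp K.incl

/-- The current Kac-Moody Lie algebra `g_A = (A ⊗ g') ⊕ h''`. -/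
abbrev Current (R : CartanRealization C H) (K : LieSubalgebra ℂ R.KacMoody) :
    Type (max uι uH uA) :=
  LieAlgebra.SemiDirectSum (A ⊗[ℂ] R.derived) K (R.currentAction A K)

/-- The enveloping algebra `U(g_A)`. -/
abbrev CurrentU (R : CartanRealization C H) (K : LieSubalgebra ℂ R.KacMoody) :
    Type (max uι uH uA) :=
  UniversalEnvelopingAlgebra ℂ (R.Current A K)

/-- The inclusion of `(A ⊗ h') ⊕ h''` in `g_A`. -/
def currentCartan (R : CartanRealization C H) (K : LieSubalgebra ℂ R.KacMoody)
    (t : (A ⊗[ℂ] R.cartanDerived) × K) : R.Current A K :=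
  ⟨R.cartanDerived.subtype.lTensor A t.1, t.2⟩

variable {A}

/-- The left ideal of `U(g_A)` generated by `N⁺ ⊗ A` and by all `h - ψ(h)` with
`h ∈ (A ⊗ h') ⊕ h''`, that is, the left ideal generated by the kernel of the
action of `U(B)` on the one-dimensional module `ℂ(ψ)`. -/
def vermaIdeal {R : CartanRealization C H} {K : LieSubalgebra ℂ R.KacMoody}
    (ψ : ((A ⊗[ℂ] R.cartanDerived) × K) →ₗ[ℂ] ℂ) : Submodule (R.CurrentU A K) (R.CurrentU A K) :=
  Submodule.span _
    ({u | ∃ (a : A) (x : R.derived), x ∈ R.nPos ∧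
        u = UniversalEnvelopingAlgebra.ι ℂ (⟨a ⊗ₜ[ℂ] x, 0⟩ : R.Current A K)} ∪
      {u | ∃ t : (A ⊗[ℂ] R.cartanDerived) × K,
        u = UniversalEnvelopingAlgebra.ι ℂ (R.currentCartan A K t) -
          algebraMap ℂ (R.CurrentU A K) (ψ t)})

/-- The induced module `M(ψ) = U(g_A) ⊗_{U(B)} ℂ(ψ)`, as the quotient of `U(g_A)` by a left
ideal. -/
abbrev Verma {R : CartanRealization C H} {K : LieSubalgebra ℂ R.KacMoody}
    (ψ : ((A ⊗[ℂ] R.cartanDerived) × K) →ₗ[ℂ] ℂ) : Type (max uι uH uA) :=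
  R.CurrentU A K ⧸ vermaIdeal ψ

/-- The largest proper submodule of `M(ψ)`, as the sum of all proper submodules. -/
def maxSubmodule {R : CartanRealization C H} {K : LieSubalgebra ℂ R.KacMoody}
    (ψ : ((A ⊗[ℂ] R.cartanDerived) × K) →ₗ[ℂ] ℂ) : Submodule (R.CurrentU A K) (Verma ψ) :=
  sSup {N | N ≠ ⊤}

/-- The irreducible quotient `V(ψ)` of `M(ψ)`. -/
abbrev Irr {R : CartanRealization C H} {K : LieSubalgebra ℂ R.KacMoody}
    (ψ : ((A ⊗[ℂ] R.cartanDerived) × K) →ₗ[ℂ] ℂ) : Type (max uι uH uA) :=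
  Verma ψ ⧸ maxSubmodule ψ

/-- The weight space of `V(ψ)` of weight `μ ∈ h^*`. An element `z = x + y` of `h = h' ⊕ h''` is
the element `1 ⊗ x + y` of `g_A`. -/
def weightSpace {R : CartanRealization C H} {K : LieSubalgebra ℂ R.KacMoody}
    (ψ : ((A ⊗[ℂ] R.cartanDerived) × K) →ₗ[ℂ] ℂ) (μ : Module.Dual ℂ R.cartan) :
    Submodule ℂ (Irr ψ) where
  carrier := {v | ∀ (z : R.cartan) (x : R.cartanDerived) (y : K),
    (z : R.KacMoody) = ((x : R.derived) : R.KacMoody) + (y : R.KacMoody) →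
      UniversalEnvelopingAlgebra.ι ℂ (R.currentCartan A K ((1 : A) ⊗ₜ[ℂ] x, y)) • v = μ z • v}
  zero_mem' z x y _ := by simp
  add_mem' {v w} hv hw z x y h := by rw [smul_add, smul_add, hv z x y h, hw z x y h]
  smul_mem' c v hv z x y h := by
    rw [smul_comm, hv z x y h, smul_comm]

end

end CartanRealization

/-
The current algebra is generated by the elements `eᵢ ⊗ a`, `fᵢ ⊗ a` and the Cartan part, with
relations of Chevalley type, so a module generated by a highest weight vector `v` is the sum of the
levels spanned by the vectors `(fᵢ₁ ⊗ a₁) ⋯ (fᵢₙ ⊗ aₙ) v`. An element of `h` on which all simple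
roots take the value `1` separates the levels. Hence a proper submodule lies in the sum of the
levels of positive depth, and `V(ψ) ≠ 0` as soon as `M(ψ) ≠ 0`. Instead of the PBW theorem, the
latter rests on an explicit action of the generators on words in `ι × β`, for a basis of `A` indexed
by `β`; by the triangular decomposition, the relations of the current algebra map every word to a
combination of nonempty words.

If the weight spaces are finite-dimensional, then so is the span of the `(fᵢ ⊗ a) v`, `a ∈ A`, which
share a weight. When `(fᵢ ⊗ a) v = 0` for all `i`, applying `eᵢ ⊗ b` yields `ψ(αᵢ^∨ ⊗ ba) = 0`, so
the `a` with `ψ(αᵢ^∨ ⊗ ba) = 0` for all `i` and `b` form an ideal of finite codimension.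
Conversely, if `ψ` vanishes on `h' ⊗ I`, the ideal `g' ⊗ I` maps `M(ψ)` into the levels of positive
depth, so it annihilates `V(ψ)`; then every level is finite-dimensional.
-/

section Eigenspaces

variable {k V : Type*} [Field k] [AddCommGroup V] [Module k V]

/-- The sum of the eigenspaces of `φ` with eigenvalues in `S`. -/
def sumEigenspaces (φ : Module.End k V) (S : Set k) : Submodule k V := ⨆ μ ∈ S, φ.eigenspace μ

theorem sumEigenspaces_le_iff {φ : Module.End k V} {S : Set k} {p : Submodule k V} :
    sumEigenspaces φ S ≤ p ↔ ∀ μ ∈ S, φ.eigenspace μ ≤ p :=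
  iSup₂_le_iff

theorem eigenspace_le_sumEigenspaces (φ : Module.End k V) {S : Set k} {μ : k} (h : μ ∈ S) :
    φ.eigenspace μ ≤ sumEigenspaces φ S :=
  le_biSup φ.eigenspace h

theorem sumEigenspaces_mono (φ : Module.End k V) {S S' : Set k} (h : S ⊆ S') :
    sumEigenspaces φ S ≤ sumEigenspaces φ S' :=
  biSup_mono h

theorem disjoint_sumEigenspaces (φ : Module.End k V) {S S' : Set k} (h : Disjoint S S') :
    Disjoint (sumEigenspaces φ S) (sumEigenspaces φ S') :=
  φ.eigenspaces_iSupIndep.disjoint_biSup_biSup h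

theorem eq_zero_of_add_mem_sumEigenspaces {φ : Module.End k V} {S S' : Set k}
    (h : Disjoint S S') {x y : V} (hx : x ∈ sumEigenspaces φ S) (hy : y ∈ sumEigenspaces φ S')
    (hxy : x + y ∈ sumEigenspaces φ S') : x = 0 :=
  Submodule.disjoint_def.1 (disjoint_sumEigenspaces φ h) x hx ((add_mem_cancel_right hy).1 hxy)

theorem map_mkQ_sumEigenspaces_le {φ : Module.End k V} {p : Submodule k V} (hp : p ≤ p.comap φ)
    (S : Set k) : (sumEigenspaces φ S).map p.mkQ ≤ sumEigenspaces (p.mapQ p φ hp) S := by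
  refine Submodule.map_le_iff_le_comap.2 (sumEigenspaces_le_iff.2 fun μ hμ x hx => ?_)
  refine eigenspace_le_sumEigenspaces _ hμ ?_
  rw [Module.End.mem_eigenspace_iff] at hx ⊢
  rw [Submodule.mkQ_apply, Submodule.mapQ_apply, hx, Submodule.Quotient.mk_smul]

theorem mem_of_add_mem_of_invariant {φ : Module.End k V} {p : Submodule k V}
    (hp : p ≤ p.comap φ) {S S' : Set k} (h : Disjoint S S') {x y : V}
    (hx : x ∈ sumEigenspaces φ S) (hy : y ∈ sumEigenspaces φ S') (hxy : x + y ∈ p) : x ∈ p := by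
  have hx' := map_mkQ_sumEigenspaces_le hp S (Submodule.mem_map_of_mem hx)
  have hy' := map_mkQ_sumEigenspaces_le hp S' (Submodule.mem_map_of_mem hy)
  rw [← Submodule.ker_mkQ p, LinearMap.mem_ker] at hxy ⊢
  refine eq_zero_of_add_mem_sumEigenspaces h hx' hy' ?_
  rw [← map_add, hxy]
  exact zero_mem _

theorem eigenspace_le_iSup_of_iSup_eq_top {κ : Type*} {φ : Module.End k V} {p : κ → Submodule k V}
    {c : κ → k} (hp : ∀ n, p n ≤ φ.eigenspace (c n)) (htop : ⨆ n, p n = ⊤) (μ : k) :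
    φ.eigenspace μ ≤ ⨆ (n) (_ : c n = μ), p n := by
  intro x hx
  have hsup : (⨆ n, p n) ≤ (⨆ (n) (_ : c n = μ), p n) ⊔ ⨆ (n) (_ : c n ≠ μ), p n :=
    iSup_le fun n => by
      by_cases hn : c n = μ
      · exact le_sup_of_le_left (le_iSup₂_of_le n hn le_rfl)
      · exact le_sup_of_le_right (le_iSup₂_of_le n hn le_rfl)
  obtain ⟨y, hy, z, hz, rfl⟩ := Submodule.mem_sup.1 (hsup (htop ▸ Submodule.mem_top (x := x)))
  have hy' : y ∈ φ.eigenspace μ := (iSup₂_le fun n hn => hn ▸ hp n :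
    (⨆ (n) (_ : c n = μ), p n) ≤ φ.eigenspace μ) hy
  have hz' : z ∈ sumEigenspaces φ {μ}ᶜ := (iSup₂_le fun n hn =>
    (hp n).trans (eigenspace_le_sumEigenspaces φ hn) :
    (⨆ (n) (_ : c n ≠ μ), p n) ≤ sumEigenspaces φ {μ}ᶜ) hz
  have hμ := eigenspace_le_sumEigenspaces φ (Set.mem_singleton μ)
  have hz0 : z = 0 := eq_zero_of_add_mem_sumEigenspaces disjoint_compl_left hz' (hμ hy')
    (hμ (add_comm y z ▸ hx))
  rwa [hz0, add_zero]

end Eigenspaces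

section

attribute [local instance 100] LieRing.ofAssociativeRing

section LieSpan

variable {k L : Type*} [CommRing k] [LieRing L] [LieAlgebra k L]

theorem lie_mem_of_mem_lieSpan {s : Set L} {P : Submodule k L}
    (hs : (LieSubalgebra.lieSpan k L s).toSubmodule ≤ P)
    (hP : ∀ u ∈ P, ∀ y ∈ LieSubalgebra.lieSpan k L s, ⁅u, y⁆ ∈ LieSubalgebra.lieSpan k L s)
    {x : L} (hx : ∀ y ∈ s, ⁅x, y⁆ ∈ P) {y : L} (hy : y ∈ LieSubalgebra.lieSpan k L s) :
    ⁅x, y⁆ ∈ P := by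
  induction hy using LieSubalgebra.lieSpan_induction with
  | mem y hy => exact hx y hy
  | zero => rw [lie_zero]; exact zero_mem P
  | add y z _ _ hy hz => rw [lie_add]; exact add_mem hy hz
  | smul c y _ hy => rw [lie_smul]; exact P.smul_mem c hy
  | lie y z hy' hz' hy hz =>
    rw [leibniz_lie, ← lie_skew y]
    exact hs (add_mem (hP _ hy _ hz') (neg_mem (hP _ hz _ hy')))

end LieSpan

section AdEigenspaces

variable {k L : Type*} [Field k] [LieRing L] [LieAlgebra k L]

theorem lie_mem_eigenspace_ad {h x y : L} {μ ν : k}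
    (hx : x ∈ (LieAlgebra.ad k L h).eigenspace μ) (hy : y ∈ (LieAlgebra.ad k L h).eigenspace ν) :
    ⁅x, y⁆ ∈ (LieAlgebra.ad k L h).eigenspace (μ + ν) := by
  rw [Module.End.mem_eigenspace_iff, LieAlgebra.ad_apply] at hx hy ⊢
  rw [leibniz_lie, hx, hy, smul_lie, lie_smul, add_smul]

theorem lie_mem_sumEigenspaces_ad {h : L} {S : Set k} (hS : ∀ μ ∈ S, ∀ ν ∈ S, μ + ν ∈ S) {x y : L}
    (hx : x ∈ sumEigenspaces (LieAlgebra.ad k L h) S)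
    (hy : y ∈ sumEigenspaces (LieAlgebra.ad k L h) S) :
    ⁅x, y⁆ ∈ sumEigenspaces (LieAlgebra.ad k L h) S := by
  have hle : Submodule.map₂ (LieAlgebra.ad k L : L →ₗ[k] Module.End k L)
      (sumEigenspaces (LieAlgebra.ad k L h) S) (sumEigenspaces (LieAlgebra.ad k L h) S) ≤
      sumEigenspaces (LieAlgebra.ad k L h) S := by
    conv_lhs => simp only [sumEigenspaces, Submodule.map₂_iSup_left, Submodule.map₂_iSup_right]
    simp only [iSup_le_iff, Submodule.map₂_le]
    intro μ hμ ν hν x hx y hy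
    exact eigenspace_le_sumEigenspaces _ (hS _ ‹_› _ ‹_›) (lie_mem_eigenspace_ad hx hy)
  exact hle (Submodule.apply_mem_map₂ _ hx hy)

theorem lieSpan_le_sumEigenspaces_ad {h : L} {S : Set k} (hS : ∀ μ ∈ S, ∀ ν ∈ S, μ + ν ∈ S)
    {s : Set L} (hs : s ⊆ sumEigenspaces (LieAlgebra.ad k L h) S) :
    (LieSubalgebra.lieSpan k L s).toSubmodule ≤ sumEigenspaces (LieAlgebra.ad k L h) S :=
  LieSubalgebra.lieSpan_le (K := { sumEigenspaces (LieAlgebra.ad k L h) S with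
    lie_mem' := lie_mem_sumEigenspaces_ad hS }).2 hs

end AdEigenspaces

section Representations

variable {k L V : Type*} [CommRing k] [LieRing L] [LieAlgebra k L] [AddCommGroup V] [Module k V]

theorem rep_lie (ρ : L →ₗ⁅k⁆ Module.End k V) (x y : L) (w : V) :
    ρ ⁅x, y⁆ w = ρ x (ρ y w) - ρ y (ρ x w) := by
  rw [LieHom.map_lie]
  rfl

theorem rep_rep (ρ : L →ₗ⁅k⁆ Module.End k V) (x y : L) (w : V) :
    ρ x (ρ y w) = ρ y (ρ x w) + ρ ⁅x, y⁆ w := by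
  rw [rep_lie, add_sub_cancel]

/-- The subalgebra of the elements of `L` whose operators map `p` to `q`. Without `q ≤ p` it would
not be closed under brackets. -/
def mapsToSubalgebra (ρ : L →ₗ⁅k⁆ Module.End k V) {p q : Submodule k V} (hqp : q ≤ p) :
    LieSubalgebra k L where
  carrier := {x | ∀ w ∈ p, ρ x w ∈ q}
  zero_mem' w _ := by simp
  add_mem' hx hy w hw := by simpa using add_mem (hx w hw) (hy w hw)
  smul_mem' c x hx w hw := by simpa using q.smul_mem c (hx w hw)
  lie_mem' {x y} hx hy w hw := by
    rw [rep_lie]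
    exact sub_mem (hx _ (hqp (hy w hw))) (hy _ (hqp (hx w hw)))

end Representations

/-- Simple roots and coroots of a vector space `T` with values and coefficients in a commutative
algebra `A`: the datum entering the Chevalley relations of a current algebra. -/
structure ChevalleyDatum (k ι A T : Type*) [CommRing k] [CommRing A] [Algebra k A]
    [AddCommGroup T] [Module k T] where
  root : ι → T →ₗ[k] A
  coroot : ι → A →ₗ[k] T

/-- Elements `e i a`, `f i a` and `t s` of a Lie algebra satisfying the Chevalley relations with
coefficients in `A`; `e i a` stands for `eᵢ ⊗ a`. -/
structure ChevalleyGenerators {k ι A T : Type*} [CommRing k] [CommRing A] [Algebra k A]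
    [AddCommGroup T] [Module k T] (D : ChevalleyDatum k ι A T) (L : Type*) [LieRing L]
    [LieAlgebra k L] where
  e : ι → A →ₗ[k] L
  f : ι → A →ₗ[k] L
  t : T →ₗ[k] L
  e_f_same : ∀ i a b, ⁅e i a, f i b⁆ = t (D.coroot i (a * b))
  e_f_ne : ∀ i j a b, i ≠ j → ⁅e i a, f j b⁆ = 0
  t_e : ∀ s i a, ⁅t s, e i a⁆ = e i (D.root i s * a)
  t_f : ∀ s i a, ⁅t s, f i a⁆ = -f i (D.root i s * a)
  t_t : ∀ s s', ⁅t s, t s'⁆ = 0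

namespace ChevalleyDatum

variable {k ι A T : Type*} [CommRing k] [CommRing A] [Algebra k A] [AddCommGroup T] [Module k T]

/-- The datum with all roots and coroots negated, for which the `e i` and `f i` trade places. -/
def opposite (D : ChevalleyDatum k ι A T) : ChevalleyDatum k ι A T where
  root i := -D.root i
  coroot i := -D.coroot i

/-- The element `h` takes the value `1` at all simple roots, so that its eigenvalues count the
generators `f i a` in a monomial. -/
def IsGradingElement (D : ChevalleyDatum k ι A T) (h : T) : Prop := ∀ i, D.root i h = 1

/-- The span of all multiples of the simple coroots. -/
def corootSpan (D : ChevalleyDatum k ι A T) : Submodule k T := ⨆ i, LinearMap.range (D.coroot i)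

/-- The elements of `A` all of whose multiples lead to multiples of simple coroots on which the
weight `χ` vanishes. -/
def corootIdeal (D : ChevalleyDatum k ι A T) (χ : T →ₗ[k] k) : Ideal A where
  carrier := {a | ∀ i b, χ (D.coroot i (b * a)) = 0}
  zero_mem' i b := by simp
  add_mem' ha ha' i b := by rw [mul_add, map_add, map_add, ha i b, ha' i b, add_zero]
  smul_mem' c a ha i b := by rw [smul_eq_mul, ← mul_assoc]; exact ha i (b * c)

variable {D : ChevalleyDatum k ι A T}

theorem coroot_mem_corootSpan (D : ChevalleyDatum k ι A T) (i : ι) (a : A) :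
    D.coroot i a ∈ D.corootSpan :=
  Submodule.mem_iSup_of_mem (p := fun i => LinearMap.range (D.coroot i)) i ⟨a, rfl⟩

theorem corootSpan_opposite : D.opposite.corootSpan = D.corootSpan :=
  iSup_congr fun i => LinearMap.range_neg (D.coroot i)

end ChevalleyDatum

namespace ChevalleyGenerators

section Triangular

variable {k ι A T : Type*} [CommRing k] [CommRing A] [Algebra k A] [AddCommGroup T] [Module k T]
  {D : ChevalleyDatum k ι A T} {L : Type*} [LieRing L] [LieAlgebra k L]

/-- The same generators with the roles of `e` and `f` exchanged. -/
def opposite (G : ChevalleyGenerators D L) : ChevalleyGenerators D.opposite L where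
  e := G.f
  f := G.e
  t := G.t
  e_f_same i a b := by
    rw [← lie_skew, G.e_f_same, mul_comm]
    simp [ChevalleyDatum.opposite]
  e_f_ne i j a b hij := by rw [← lie_skew, G.e_f_ne j i b a hij.symm, neg_zero]
  t_e s i a := by simp [ChevalleyDatum.opposite, G.t_f]
  t_f s i a := by simp [ChevalleyDatum.opposite, G.t_e]
  t_t := G.t_t

/-- The subalgebra generated by the `e i a`. -/
def upper (G : ChevalleyGenerators D L) : LieSubalgebra k L :=
  LieSubalgebra.lieSpan k L (⋃ i, Set.range (G.e i))

/-- The subalgebra generated by the `f i a`. -/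
def lower (G : ChevalleyGenerators D L) : LieSubalgebra k L :=
  LieSubalgebra.lieSpan k L (⋃ i, Set.range (G.f i))

/-- The subalgebra generated by all `e i a`, `f i a` and `t s`. -/
def generated (G : ChevalleyGenerators D L) : LieSubalgebra k L :=
  LieSubalgebra.lieSpan k L
    ((⋃ i, Set.range (G.e i)) ∪ (⋃ i, Set.range (G.f i)) ∪ Set.range G.t)

variable (G : ChevalleyGenerators D L)

theorem upper_le_iff {P : LieSubalgebra k L} : G.upper ≤ P ↔ ∀ i a, G.e i a ∈ P := by
  simp [upper, LieSubalgebra.lieSpan_le, Set.range_subset_iff]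

theorem lower_le_iff {P : LieSubalgebra k L} : G.lower ≤ P ↔ ∀ i a, G.f i a ∈ P :=
  G.opposite.upper_le_iff

theorem generated_le_iff {P : LieSubalgebra k L} :
    G.generated ≤ P ↔ (∀ i a, G.e i a ∈ P) ∧ (∀ i a, G.f i a ∈ P) ∧ ∀ s, G.t s ∈ P := by
  simp [generated, LieSubalgebra.lieSpan_le, Set.range_subset_iff, and_assoc]

theorem e_mem_upper (i : ι) (a : A) : G.e i a ∈ G.upper := G.upper_le_iff.1 le_rfl i a

theorem f_mem_lower (i : ι) (a : A) : G.f i a ∈ G.lower := G.lower_le_iff.1 le_rfl i a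

theorem e_mem_generated (i : ι) (a : A) : G.e i a ∈ G.generated :=
  (G.generated_le_iff.1 le_rfl).1 i a

theorem f_mem_generated (i : ι) (a : A) : G.f i a ∈ G.generated :=
  (G.generated_le_iff.1 le_rfl).2.1 i a

theorem t_mem_generated (s : T) : G.t s ∈ G.generated := (G.generated_le_iff.1 le_rfl).2.2 s

theorem upper_le_generated : G.upper ≤ G.generated :=
  G.upper_le_iff.2 G.e_mem_generated

theorem lower_le_generated : G.lower ≤ G.generated :=
  G.lower_le_iff.2 G.f_mem_generated

theorem lie_t_mem_upper (s : T) {x : L} (hx : x ∈ G.upper) : ⁅G.t s, x⁆ ∈ G.upper := by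
  refine lie_mem_of_mem_lieSpan (P := G.upper.toSubmodule) le_rfl
    (fun u hu y hy => G.upper.lie_mem hu hy) (fun y hy => ?_) hx
  obtain ⟨i, a, rfl⟩ := Set.mem_iUnion.1 hy
  rw [G.t_e]
  exact G.e_mem_upper _ _

theorem lie_f_mem_upper_sup (i : ι) (a : A) {x : L} (hx : x ∈ G.upper) :
    ⁅G.f i a, x⁆ ∈ G.upper.toSubmodule ⊔ D.corootSpan.map G.t := by
  refine lie_mem_of_mem_lieSpan le_sup_left (fun u hu y hy => ?_) (fun y hy => ?_) hx
  · obtain ⟨z, hz, _, ⟨s, _, rfl⟩, rfl⟩ := Submodule.mem_sup.1 hu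
    rw [add_lie]
    exact add_mem (G.upper.lie_mem hz hy) (G.lie_t_mem_upper s hy)
  · obtain ⟨j, b, rfl⟩ := Set.mem_iUnion.1 hy
    rw [← lie_skew]
    obtain rfl | hji := eq_or_ne j i
    · rw [G.e_f_same]
      exact Submodule.mem_sup_right
        (neg_mem (Submodule.mem_map_of_mem (D.coroot_mem_corootSpan _ _)))
    · rw [G.e_f_ne _ _ _ _ hji, neg_zero]
      exact zero_mem _

/-- The subspace `lower + t Q + upper`. -/
def triangular (Q : Submodule k T) : Submodule k L :=
  G.lower.toSubmodule ⊔ Q.map G.t ⊔ G.upper.toSubmodule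

theorem triangular_opposite (Q : Submodule k T) : G.opposite.triangular Q = G.triangular Q := by
  change G.upper.toSubmodule ⊔ Q.map G.t ⊔ G.lower.toSubmodule = _
  rw [triangular, sup_comm, ← sup_assoc, sup_right_comm]

variable {G} in
theorem mem_triangular {Q : Submodule k T} {x : L} :
    x ∈ G.triangular Q ↔ ∃ y ∈ G.lower, ∃ s ∈ Q, ∃ z ∈ G.upper, y + G.t s + z = x := by
  simp [triangular, Submodule.mem_sup]

theorem upper_le_triangular (Q : Submodule k T) : G.upper.toSubmodule ≤ G.triangular Q :=
  le_sup_right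

theorem lower_le_triangular (Q : Submodule k T) : G.lower.toSubmodule ≤ G.triangular Q :=
  le_sup_left.trans le_sup_left

theorem map_t_le_triangular (Q : Submodule k T) : Q.map G.t ≤ G.triangular Q :=
  le_sup_right.trans le_sup_left

theorem lie_t_mem_triangular (Q : Submodule k T) (s : T) {x : L} (hx : x ∈ G.triangular Q) :
    ⁅G.t s, x⁆ ∈ G.triangular Q := by
  obtain ⟨y, hy, s', _, z, hz, rfl⟩ := mem_triangular.1 hx
  rw [lie_add, lie_add, G.t_t, add_zero]
  exact add_mem (G.lower_le_triangular Q (G.opposite.lie_t_mem_upper s hy))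
    (G.upper_le_triangular Q (G.lie_t_mem_upper s hz))

theorem lie_f_mem_triangular {Q : Submodule k T} (hQ : D.corootSpan ≤ Q) (i : ι) (a : A) {x : L}
    (hx : x ∈ G.triangular Q) : ⁅G.f i a, x⁆ ∈ G.triangular Q := by
  obtain ⟨y, hy, s, _, z, hz, rfl⟩ := mem_triangular.1 hx
  have hle : G.upper.toSubmodule ⊔ D.corootSpan.map G.t ≤ G.triangular Q :=
    sup_le (G.upper_le_triangular Q) ((Submodule.map_mono hQ).trans (G.map_t_le_triangular Q))
  rw [lie_add, lie_add, ← lie_skew _ (G.t s), G.t_f, neg_neg]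
  exact add_mem (G.lower_le_triangular Q
    (add_mem (G.lower.lie_mem (G.f_mem_lower i a) hy) (G.f_mem_lower _ _)))
    (hle (G.lie_f_mem_upper_sup i a hz))

theorem lie_e_mem_triangular {Q : Submodule k T} (hQ : D.corootSpan ≤ Q) (i : ι) (a : A) {x : L}
    (hx : x ∈ G.triangular Q) : ⁅G.e i a, x⁆ ∈ G.triangular Q := by
  rw [← triangular_opposite] at hx ⊢
  exact G.opposite.lie_f_mem_triangular (ChevalleyDatum.corootSpan_opposite.trans_le hQ) i a hx

theorem lie_mem_triangular {Q : Submodule k T} (hQ : D.corootSpan ≤ Q) {x y : L}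
    (hx : x ∈ G.generated) (hy : y ∈ G.triangular Q) : ⁅x, y⁆ ∈ G.triangular Q :=
  G.generated_le_iff (P := mapsToSubalgebra (LieAlgebra.ad k L) (le_refl (G.triangular Q))).2
    ⟨fun i a _ => G.lie_e_mem_triangular hQ i a, fun i a _ => G.lie_f_mem_triangular hQ i a,
      fun s _ => G.lie_t_mem_triangular Q s⟩ hx y hy

theorem generated_le_triangular : G.generated.toSubmodule ≤ G.triangular ⊤ := by
  intro x hx
  induction hx using LieSubalgebra.lieSpan_induction with
  | mem x hx =>
    simp only [Set.mem_union, Set.mem_iUnion] at hx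
    obtain (⟨i, a, rfl⟩ | ⟨i, a, rfl⟩) | ⟨s, rfl⟩ := hx
    · exact G.upper_le_triangular _ (G.e_mem_upper i a)
    · exact G.lower_le_triangular _ (G.f_mem_lower i a)
    · exact G.map_t_le_triangular _ (Submodule.mem_map_of_mem trivial)
  | zero => exact zero_mem _
  | add x z _ _ hx hz => exact add_mem hx hz
  | smul c x _ hx => exact Submodule.smul_mem _ c hx
  | lie x z hx _ _ hz => exact G.lie_mem_triangular le_top hx hz

theorem exists_triangular_decomposition {x : L} (hx : x ∈ G.generated) :
    ∃ y ∈ G.lower, ∃ s, ∃ z ∈ G.upper, y + G.t s + z = x := by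
  simpa using mem_triangular.1 (G.generated_le_triangular hx)

theorem lie_mem_triangular_corootSpan {x x' : L} (hx : x ∈ G.generated) (hx' : x' ∈ G.generated) :
    ⁅x, x'⁆ ∈ G.triangular D.corootSpan := by
  obtain ⟨y', hy', s', z', hz', rfl⟩ := G.exists_triangular_decomposition hx'
  obtain ⟨y, hy, s, z, hz, hxyz⟩ := G.exists_triangular_decomposition hx
  have hts : ⁅G.t s', x⁆ ∈ G.triangular D.corootSpan := by
    rw [← hxyz, lie_add, lie_add, G.t_t, add_zero]
    exact add_mem (G.lie_t_mem_triangular _ s' (G.lower_le_triangular _ hy))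
      (G.lie_t_mem_triangular _ s' (G.upper_le_triangular _ hz))
  rw [lie_add, lie_add, ← lie_skew x (G.t s')]
  exact add_mem (add_mem (G.lie_mem_triangular le_rfl hx (G.lower_le_triangular _ hy'))
    (neg_mem hts)) (G.lie_mem_triangular le_rfl hx (G.upper_le_triangular _ hz'))

end Triangular

section Grading

variable {k ι A T : Type*} [Field k] [CommRing A] [Algebra k A] [AddCommGroup T] [Module k T]
  {D : ChevalleyDatum k ι A T} {L : Type*} [LieRing L] [LieAlgebra k L]

theorem upper_le_sumEigenspaces (G : ChevalleyGenerators D L) {h : T}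
    (hh : D.IsGradingElement h) :
    G.upper.toSubmodule ≤ sumEigenspaces (LieAlgebra.ad k L (G.t h)) (Int.cast '' Set.Ioi 0) := by
  refine lieSpan_le_sumEigenspaces_ad ?_ fun x hx => ?_
  · rintro _ ⟨m, hm, rfl⟩ _ ⟨n, hn, rfl⟩
    exact ⟨m + n, Set.mem_Ioi.2 (add_pos hm hn), Int.cast_add m n⟩
  · obtain ⟨i, a, rfl⟩ := Set.mem_iUnion.1 hx
    refine eigenspace_le_sumEigenspaces _ (μ := 1) (S := Int.cast '' Set.Ioi 0)
      ⟨1, by simp, Int.cast_one⟩ ?_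
    simp [G.t_e, hh i]

theorem lower_le_sumEigenspaces (G : ChevalleyGenerators D L) {h : T}
    (hh : D.IsGradingElement h) :
    G.lower.toSubmodule ≤ sumEigenspaces (LieAlgebra.ad k L (G.t h)) (Int.cast '' Set.Iio 0) := by
  refine lieSpan_le_sumEigenspaces_ad ?_ fun x hx => ?_
  · rintro _ ⟨m, hm, rfl⟩ _ ⟨n, hn, rfl⟩
    exact ⟨m + n, Set.mem_Iio.2 (add_neg hm hn), Int.cast_add m n⟩
  · obtain ⟨i, a, rfl⟩ := Set.mem_iUnion.1 hx
    refine eigenspace_le_sumEigenspaces _ (μ := -1) (S := Int.cast '' Set.Iio 0)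
      ⟨-1, by simp, by simp⟩ ?_
    simp [G.t_f, hh i]

theorem eq_zero_of_lower_add_t_add_pos [CharZero k] (G : ChevalleyGenerators D L) {h : T}
    (hh : D.IsGradingElement h) {y z : L} {s : T} (hy : y ∈ G.lower)
    (hz : z ∈ sumEigenspaces (LieAlgebra.ad k L (G.t h)) (Int.cast '' Set.Ioi 0))
    (hyz : y + G.t s + z = 0) : y = 0 ∧ G.t s = 0 := by
  have disjoint_cast {S S' : Set ℤ} (hS : Disjoint S S') :
      Disjoint (Int.cast '' S : Set k) (Int.cast '' S') :=
    (Set.disjoint_image_iff Int.cast_injective).2 hS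
  have hs : G.t s ∈ sumEigenspaces (LieAlgebra.ad k L (G.t h)) (Int.cast '' {0}) :=
    eigenspace_le_sumEigenspaces _ (μ := 0) (S := Int.cast '' {0}) ⟨0, rfl, Int.cast_zero⟩
      (by simp [G.t_t])
  have hsz : G.t s + z ∈ sumEigenspaces (LieAlgebra.ad k L (G.t h)) (Int.cast '' Set.Ici 0) :=
    add_mem (sumEigenspaces_mono _ (Set.image_mono (by simp)) hs)
      (sumEigenspaces_mono _ (Set.image_mono Set.Ioi_subset_Ici_self) hz)
  have hy0 : y = 0 :=
    eq_zero_of_add_mem_sumEigenspaces (disjoint_cast (Set.Iio_disjoint_Ici le_rfl))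
      (G.lower_le_sumEigenspaces hh hy) hsz (by rw [← add_assoc, hyz]; exact zero_mem _)
  rw [hy0, zero_add] at hyz
  refine ⟨hy0, eq_zero_of_add_mem_sumEigenspaces (disjoint_cast (by simp)) hs hz ?_⟩
  rw [hyz]
  exact zero_mem _

end Grading

section HighestWeight

variable {k ι A T : Type*} [CommRing k] [CommRing A] [Algebra k A] [AddCommGroup T] [Module k T]
  {D : ChevalleyDatum k ι A T} {L : Type*} [LieRing L] [LieAlgebra k L]
  {V : Type*} [AddCommGroup V] [Module k V]

/-- The vector `v` has weight `χ` and is annihilated by all `e i a`. It is allowed to be zero. -/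
structure IsHighestWeight (G : ChevalleyGenerators D L) (ρ : L →ₗ⁅k⁆ Module.End k V) (χ : T → k)
    (v : V) : Prop where
  e_eq_zero : ∀ i a, ρ (G.e i a) v = 0
  t_eq_smul : ∀ s, ρ (G.t s) v = χ s • v

variable (G : ChevalleyGenerators D L) (ρ : L →ₗ⁅k⁆ Module.End k V) (v : V)

/-- The span of all `f i₁ a₁ ⋯ f iₙ aₙ v`, as the level of depth `n` below the line through `v`. -/
def level : ℕ → Submodule k V
  | 0 => Submodule.span k {v}
  | n + 1 => ⨆ i, Submodule.map₂ LinearMap.id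
      (LinearMap.range ((ρ : L →ₗ[k] Module.End k V) ∘ₗ G.f i)) (level n)

/-- The sum of the levels of all depths. -/
def levels : Submodule k V := ⨆ n, G.level ρ v n

/-- The sum of the levels of positive depth. -/
def lowerLevels : Submodule k V := ⨆ n, G.level ρ v (n + 1)

variable {ρ v}

theorem level_succ_le_iff {n : ℕ} {p : Submodule k V} :
    G.level ρ v (n + 1) ≤ p ↔ ∀ i a, ∀ w ∈ G.level ρ v n, ρ (G.f i a) w ∈ p := by
  simp [level, Submodule.map₂_le]

theorem f_mem_level (i : ι) (a : A) {n : ℕ} {w : V} (hw : w ∈ G.level ρ v n) :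
    ρ (G.f i a) w ∈ G.level ρ v (n + 1) :=
  G.level_succ_le_iff.1 le_rfl i a w hw

theorem mem_level_zero : v ∈ G.level ρ v 0 := Submodule.mem_span_singleton_self v

theorem level_le_levels (n : ℕ) : G.level ρ v n ≤ G.levels ρ v := le_iSup (G.level ρ v) n

theorem level_succ_le_lowerLevels (n : ℕ) : G.level ρ v (n + 1) ≤ G.lowerLevels ρ v :=
  le_iSup (fun n => G.level ρ v (n + 1)) n

theorem lowerLevels_le_levels : G.lowerLevels ρ v ≤ G.levels ρ v :=
  iSup_le fun n => G.level_le_levels (n + 1)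

theorem mem_levels : v ∈ G.levels ρ v := G.level_le_levels 0 G.mem_level_zero

theorem f_mem_lowerLevels (i : ι) (a : A) {w : V} (hw : w ∈ G.levels ρ v) :
    ρ (G.f i a) w ∈ G.lowerLevels ρ v := by
  have h : G.levels ρ v ≤ (G.lowerLevels ρ v).comap (ρ (G.f i a)) :=
    iSup_le fun n _ hw => G.level_succ_le_lowerLevels n (G.f_mem_level i a hw)
  exact h hw

theorem levels_le_span_sup_lowerLevels :
    G.levels ρ v ≤ Submodule.span k {v} ⊔ G.lowerLevels ρ v := by
  refine iSup_le fun n => ?_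
  cases n with
  | zero => exact le_sup_left
  | succ n => exact (G.level_succ_le_lowerLevels n).trans le_sup_right

theorem mem_lowerLevels_of_mem_lower {x : L} (hx : x ∈ G.lower) {w : V}
    (hw : w ∈ G.levels ρ v) : ρ x w ∈ G.lowerLevels ρ v :=
  G.lower_le_iff (P := mapsToSubalgebra ρ G.lowerLevels_le_levels).2
    (fun i a _ hw => G.f_mem_lowerLevels i a hw) hx w hw

theorem mem_lowerLevels_of_forall_lie_f_mem {J : Set L} (hJ : ∀ y ∈ J, ∀ i a, ⁅y, G.f i a⁆ ∈ J)
    (hJv : ∀ y ∈ J, ρ y v ∈ G.lowerLevels ρ v) {y : L} (hy : y ∈ J) {w : V}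
    (hw : w ∈ G.levels ρ v) : ρ y w ∈ G.lowerLevels ρ v := by
  suffices h : ∀ n, ∀ y ∈ J, G.level ρ v n ≤ (G.lowerLevels ρ v).comap (ρ y) from
    (iSup_le fun n => h n y hy : G.levels ρ v ≤ (G.lowerLevels ρ v).comap (ρ y)) hw
  intro n
  induction n with
  | zero =>
    intro y hy
    rw [level, Submodule.span_singleton_le_iff_mem]
    exact hJv y hy
  | succ n ih =>
    intro y hy
    refine G.level_succ_le_iff.2 fun i a w hw => ?_
    rw [Submodule.mem_comap, rep_rep]
    exact add_mem (G.f_mem_lowerLevels i a (G.lowerLevels_le_levels (ih y hy hw)))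
      (ih _ (hJ y hy i a) hw)

theorem fg_level [Finite ι]
    (hf : ∀ i, (LinearMap.range ((ρ : L →ₗ[k] Module.End k V) ∘ₗ G.f i)).FG) (n : ℕ) :
    (G.level ρ v n).FG := by
  induction n with
  | zero => exact Submodule.fg_span_singleton v
  | succ n ih => exact Submodule.fg_iSup _ fun i => (hf i).map₂ _ ih

namespace IsHighestWeight

variable {G} {χ : T → k}

theorem t_mem_level (hv : G.IsHighestWeight ρ χ v) (s : T) {n : ℕ} {w : V}
    (hw : w ∈ G.level ρ v n) : ρ (G.t s) w ∈ G.level ρ v n := by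
  induction n generalizing w with
  | zero =>
    obtain ⟨c, rfl⟩ := Submodule.mem_span_singleton.1 hw
    rw [map_smul, hv.t_eq_smul]
    exact Submodule.smul_mem _ _ (Submodule.smul_mem _ _ G.mem_level_zero)
  | succ n ih =>
    suffices h : G.level ρ v (n + 1) ≤ (G.level ρ v (n + 1)).comap (ρ (G.t s)) from h hw
    refine G.level_succ_le_iff.2 fun i a w hw => ?_
    rw [Submodule.mem_comap, rep_rep, G.t_f, map_neg, LinearMap.neg_apply]
    exact add_mem (G.f_mem_level _ _ (ih hw)) (neg_mem (G.f_mem_level _ _ hw))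

theorem lie_e_f_mem_level (hv : G.IsHighestWeight ρ χ v) (i j : ι) (a b : A) {n : ℕ} {w : V}
    (hw : w ∈ G.level ρ v n) : ρ ⁅G.e i a, G.f j b⁆ w ∈ G.level ρ v n := by
  obtain rfl | hij := eq_or_ne i j
  · rw [G.e_f_same]
    exact hv.t_mem_level _ hw
  · rw [G.e_f_ne _ _ _ _ hij, map_zero]
    exact zero_mem _

theorem e_eq_zero_of_mem_level_zero (hv : G.IsHighestWeight ρ χ v) (i : ι) (a : A) {w : V}
    (hw : w ∈ G.level ρ v 0) : ρ (G.e i a) w = 0 := by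
  obtain ⟨c, rfl⟩ := Submodule.mem_span_singleton.1 hw
  rw [map_smul, hv.e_eq_zero, smul_zero]

theorem e_mem_level (hv : G.IsHighestWeight ρ χ v) (i : ι) (a : A) {n : ℕ} {w : V}
    (hw : w ∈ G.level ρ v (n + 1)) : ρ (G.e i a) w ∈ G.level ρ v n := by
  suffices h : G.level ρ v (n + 1) ≤ (G.level ρ v n).comap (ρ (G.e i a)) from h hw
  clear hw
  induction n with
  | zero =>
    refine G.level_succ_le_iff.2 fun j b w hw => ?_
    rw [Submodule.mem_comap, rep_rep, hv.e_eq_zero_of_mem_level_zero i a hw, map_zero, zero_add]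
    exact hv.lie_e_f_mem_level i j a b hw
  | succ n ih =>
    refine G.level_succ_le_iff.2 fun j b w hw => ?_
    rw [Submodule.mem_comap, rep_rep]
    exact add_mem (G.f_mem_level _ _ (ih hw)) (hv.lie_e_f_mem_level i j a b hw)

theorem mem_levels_of_mem_generated (hv : G.IsHighestWeight ρ χ v) {x : L}
    (hx : x ∈ G.generated) {w : V} (hw : w ∈ G.levels ρ v) : ρ x w ∈ G.levels ρ v := by
  have stable {x : L} (h : ∀ n, G.level ρ v n ≤ (G.levels ρ v).comap (ρ x)) :
      ∀ w ∈ G.levels ρ v, ρ x w ∈ G.levels ρ v := iSup_le h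
  refine G.generated_le_iff (P := mapsToSubalgebra ρ (le_refl (G.levels ρ v))).2
    ⟨fun i a => stable fun n w hw => ?_,
      fun i a => stable fun n w hw => G.level_le_levels _ (G.f_mem_level i a hw),
      fun s => stable fun n w hw => G.level_le_levels n (hv.t_mem_level s hw)⟩ hx w hw
  cases n with
  | zero =>
    rw [Submodule.mem_comap, hv.e_eq_zero_of_mem_level_zero i a hw]
    exact zero_mem _
  | succ n => exact G.level_le_levels n (hv.e_mem_level i a hw)

theorem eq_zero_of_mem_upper (hv : G.IsHighestWeight ρ χ v) {x : L} (hx : x ∈ G.upper) :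
    ρ x v = 0 :=
  G.upper_le_iff (P := mapsToSubalgebra ρ (bot_le : ⊥ ≤ G.level ρ v 0)).2
    (fun i a _ hw => hv.e_eq_zero_of_mem_level_zero i a hw) hx v G.mem_level_zero

theorem apply_mem_lowerLevels (hv : G.IsHighestWeight ρ χ v) {y z : L} {s : T} (hy : y ∈ G.lower)
    (hs : χ s = 0) (hz : z ∈ G.upper) : ρ (y + G.t s + z) v ∈ G.lowerLevels ρ v := by
  rw [map_add, map_add, LinearMap.add_apply, LinearMap.add_apply, hv.t_eq_smul, hs, zero_smul,
    hv.eq_zero_of_mem_upper hz, add_zero, add_zero]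
  exact G.mem_lowerLevels_of_mem_lower hy G.mem_levels

theorem e_f_apply (hv : G.IsHighestWeight ρ χ v) (i : ι) (a b : A) :
    ρ (G.e i a) (ρ (G.f i b) v) = χ (D.coroot i (a * b)) • v := by
  rw [rep_rep, hv.e_eq_zero, map_zero, zero_add, G.e_f_same, hv.t_eq_smul]

theorem t_f_apply (hv : G.IsHighestWeight ρ χ v) {s : T} {i : ι} {c : k}
    (hc : D.root i s = algebraMap k A c) (a : A) :
    ρ (G.t s) (ρ (G.f i a) v) = (χ s - c) • ρ (G.f i a) v := by
  rw [rep_rep, hv.t_eq_smul, G.t_f, hc, ← Algebra.smul_def, map_smul, map_smul, map_neg, map_smul,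
    LinearMap.neg_apply, LinearMap.smul_apply, sub_smul, sub_eq_add_neg]

end IsHighestWeight

end HighestWeight

section HighestWeightGrading

variable {k ι A T : Type*} [Field k] [CommRing A] [Algebra k A] [AddCommGroup T] [Module k T]
  {D : ChevalleyDatum k ι A T} {L : Type*} [LieRing L] [LieAlgebra k L]
  {V : Type*} [AddCommGroup V] [Module k V] {G : ChevalleyGenerators D L}
  {ρ : L →ₗ⁅k⁆ Module.End k V} {χ : T → k} {v : V}

namespace IsHighestWeight

theorem level_le_eigenspace (hv : G.IsHighestWeight ρ χ v) {h : T} (hh : D.IsGradingElement h)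
    (n : ℕ) : G.level ρ v n ≤ (ρ (G.t h)).eigenspace (χ h - n) := by
  induction n with
  | zero =>
    rw [level, Submodule.span_singleton_le_iff_mem, Module.End.mem_eigenspace_iff, hv.t_eq_smul,
      Nat.cast_zero, sub_zero]
  | succ n ih =>
    refine G.level_succ_le_iff.2 fun i a w hw => ?_
    have hw' := Module.End.mem_eigenspace_iff.1 (ih hw)
    rw [Module.End.mem_eigenspace_iff, rep_rep, hw', map_smul, G.t_f, hh i, one_mul, map_neg,
      LinearMap.neg_apply]
    push_cast
    module

theorem lowerLevels_le_sumEigenspaces [CharZero k] (hv : G.IsHighestWeight ρ χ v) {h : T}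
    (hh : D.IsGradingElement h) :
    G.lowerLevels ρ v ≤ sumEigenspaces (ρ (G.t h)) {χ h}ᶜ := by
  refine iSup_le fun n => (hv.level_le_eigenspace hh (n + 1)).trans
    (eigenspace_le_sumEigenspaces _ ?_)
  simpa using Nat.cast_add_one_ne_zero n

theorem notMem_lowerLevels [CharZero k] (hv : G.IsHighestWeight ρ χ v) {h : T}
    (hh : D.IsGradingElement h) (hv0 : v ≠ 0) : v ∉ G.lowerLevels ρ v := fun hmem =>
  hv0 <| (disjoint_sumEigenspaces _ (disjoint_compl_right (a := {χ h}))).le_bot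
    ⟨eigenspace_le_sumEigenspaces _ (Set.mem_singleton _)
      (Module.End.mem_eigenspace_iff.2 (hv.t_eq_smul h)), hv.lowerLevels_le_sumEigenspaces hh hmem⟩

theorem cofg_corootIdeal [Finite ι] {χ : T →ₗ[k] k} (hv : G.IsHighestWeight ρ χ v) (hv0 : v ≠ 0)
    {W : ι → Submodule k V} [∀ i, FiniteDimensional k (W i)] (hW : ∀ i a, ρ (G.f i a) v ∈ W i) :
    ((D.corootIdeal χ).restrictScalars k).CoFG := by
  let fApply (i : ι) : A →ₗ[k] V := ((ρ : L →ₗ[k] Module.End k V) ∘ₗ G.f i).flip v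
  have hle : ⨅ i, LinearMap.ker (fApply i) ≤ (D.corootIdeal χ).restrictScalars k := by
    intro a ha i b
    have hf : ρ (G.f i a) v = 0 := (Submodule.mem_iInf _).1 ha i
    have hef := hv.e_f_apply i b a
    rw [hf, map_zero] at hef
    exact (smul_eq_zero.1 hef.symm).resolve_right hv0
  refine Submodule.CoFG.of_le hle (Submodule.CoFG.sInf_of_finite (Set.finite_range _) ?_)
  rintro _ ⟨i, rfl⟩
  have : FiniteDimensional k (LinearMap.range (fApply i)) :=
    Submodule.finiteDimensional_of_le (S₂ := W i) (by rintro _ ⟨a, rfl⟩; exact hW i a)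
  exact Submodule.range_fg_iff_ker_cofg.1 (Module.Finite.iff_fg.1 this)

theorem smul_mem_of_smul_add_mem [CharZero k] (hv : G.IsHighestWeight ρ χ v) {h : T}
    (hh : D.IsGradingElement h) {p : Submodule k V} (hp : ∀ w ∈ p, ρ (G.t h) w ∈ p) {c : k} {w : V}
    (hw : w ∈ G.lowerLevels ρ v) (hcw : c • v + w ∈ p) : c • v ∈ p := by
  refine mem_of_add_mem_of_invariant hp (S := {χ h}) disjoint_compl_right
    (eigenspace_le_sumEigenspaces _ (Set.mem_singleton _) ?_)
    (hv.lowerLevels_le_sumEigenspaces hh hw) hcw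
  rw [Module.End.mem_eigenspace_iff, map_smul, hv.t_eq_smul, smul_comm]

theorem finiteDimensional_eigenspace [CharZero k] (hv : G.IsHighestWeight ρ χ v) {h : T}
    (hh : D.IsGradingElement h) (hfg : ∀ n, (G.level ρ v n).FG) (htop : G.levels ρ v = ⊤) (μ : k) :
    FiniteDimensional k ((ρ (G.t h)).eigenspace μ) := by
  have hle := eigenspace_le_iSup_of_iSup_eq_top (hv.level_le_eigenspace hh) htop μ
  rw [iSup_subtype'] at hle
  have hfin : Finite {n : ℕ // χ h - n = μ} := by
    refine Set.Subsingleton.finite fun m hm n hn => ?_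
    exact Nat.cast_injective (sub_right_injective (hm.trans hn.symm))
  have := Module.Finite.iff_fg.2 (Submodule.fg_iSup
    (fun n : {n : ℕ // χ h - n = μ} => G.level ρ v n) fun n => hfg n)
  exact Submodule.finiteDimensional_of_le hle

end IsHighestWeight

end HighestWeightGrading

end ChevalleyGenerators

section Descent

variable {k L L' V : Type*} [CommRing k] [LieRing L] [LieAlgebra k L] [LieRing L']
  [LieAlgebra k L'] [AddCommGroup V] [Module k V]

theorem exists_lieHom_apply_eq_of_surjective {M : Type*} [LieRing M] [LieAlgebra k M]
    {π : L' →ₗ⁅k⁆ L} (hπ : Function.Surjective π) {φ : L' →ₗ⁅k⁆ M}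
    (hφ : ∀ x, π x = 0 → φ x = 0) : ∃ ψ : L →ₗ⁅k⁆ M, ∀ x, ψ (π x) = φ x := by
  have key {x y : L'} (h : π x = π y) : φ x = φ y :=
    sub_eq_zero.1 (by rw [← map_sub, hφ (x - y) (by rw [map_sub, h, sub_self])])
  have hs : ∀ x, π (Function.surjInv hπ x) = x := Function.surjInv_eq hπ
  refine ⟨{
    toFun x := φ (Function.surjInv hπ x)
    map_add' x y := ?_
    map_smul' c x := ?_
    map_lie' {x y} := ?_ }, fun x => key (hs _)⟩
  · rw [← map_add]
    exact key (by rw [map_add, hs, hs, hs])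
  · rw [RingHom.id_apply, ← map_smul]
    exact key (by rw [map_smul, hs, hs])
  · rw [← LieHom.map_lie]
    exact key (by rw [LieHom.map_lie, hs, hs, hs])

/-- The representation on the quotient by a stable subspace. -/
def quotientRep (ρ : L →ₗ⁅k⁆ Module.End k V) (p : Submodule k V) (hp : ∀ x, p ≤ p.comap (ρ x)) :
    L →ₗ⁅k⁆ Module.End k (V ⧸ p) where
  toFun x := p.mapQ p (ρ x) (hp x)
  map_add' x y := Submodule.linearMap_qext _ (by ext; simp)
  map_smul' c x := Submodule.linearMap_qext _ (by ext; simp)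
  map_lie' {x y} := Submodule.linearMap_qext _ (LinearMap.ext fun w => by
    simp [LieRing.of_associative_ring_bracket])

/-- The span of the images of the operators of all elements in the kernel of `π`: the subspace to
be divided out for the representation `ρ` to factor through `π`. -/
def kernelImage (π : L' →ₗ⁅k⁆ L) (ρ : L' →ₗ⁅k⁆ Module.End k V) : Submodule k V :=
  Submodule.map₂ (ρ : L' →ₗ[k] V →ₗ[k] V) (LinearMap.ker (π : L' →ₗ[k] L)) ⊤

theorem kernelImage_le_iff {π : L' →ₗ⁅k⁆ L} {ρ : L' →ₗ⁅k⁆ Module.End k V} {p : Submodule k V} :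
    kernelImage π ρ ≤ p ↔ ∀ x, π x = 0 → ∀ w, ρ x w ∈ p := by
  simp [kernelImage, Submodule.map₂_le]

theorem exists_rep_quotient_kernelImage {π : L' →ₗ⁅k⁆ L} (hπ : Function.Surjective π)
    (ρ : L' →ₗ⁅k⁆ Module.End k V) :
    ∃ ρ' : L →ₗ⁅k⁆ Module.End k (V ⧸ kernelImage π ρ),
      ∀ x w, ρ' (π x) ((kernelImage π ρ).mkQ w) = (kernelImage π ρ).mkQ (ρ x w) := by
  have hmem := kernelImage_le_iff.1 (le_refl (kernelImage π ρ))
  have hstable (x : L') : kernelImage π ρ ≤ (kernelImage π ρ).comap (ρ x) := by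
    refine kernelImage_le_iff.2 fun y hy w => ?_
    rw [Submodule.mem_comap, rep_rep]
    exact add_mem (hmem y hy _) (hmem _ (by rw [LieHom.map_lie, hy, lie_zero]) w)
  obtain ⟨ρ', hρ'⟩ := exists_lieHom_apply_eq_of_surjective hπ (φ := quotientRep ρ _ hstable)
    fun x hx => Submodule.linearMap_qext _ (LinearMap.ext fun w =>
      (Submodule.Quotient.mk_eq_zero _).2 (hmem x hx w))
  exact ⟨ρ', fun x w => LinearMap.congr_fun (hρ' x) _⟩

end Descent

namespace ChevalleyDatum

noncomputable section

variable {k ι A T β : Type*} [CommRing k] [CommRing A] [Algebra k A] [AddCommGroup T] [Module k T]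

/-- The space of formal combinations of words in `ι × β`. For a basis of `A` indexed by `β` this is
the tensor algebra on `ι →₀ A`, on which `f i a` acts by left multiplication. -/
abbrev WordSpace (k ι β : Type*) [CommRing k] : Type _ := List (ι × β) →₀ k

/-- The word `w` as a basis vector of the space of words. -/
abbrev word (w : List (ι × β)) : WordSpace k ι β := Finsupp.single w 1

/-- Left multiplication of words by the letter `(i, a)`. -/
def leftMul (b : Module.Basis β k A) (i : ι) : A →ₗ[k] Module.End k (WordSpace k ι β) :=
  b.constr k fun j => Finsupp.lmapDomain k k (List.cons (i, j))

theorem leftMul_basis_word (b : Module.Basis β k A) (i : ι) (j : β) (w : List (ι × β)) :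
    leftMul b i (b j) (word w) = word ((i, j) :: w) := by
  simp [leftMul]

theorem end_words_ext (b : Module.Basis β k A) {φ φ' : Module.End k (WordSpace k ι β)}
    (h0 : φ (word []) = φ' (word []))
    (h : ∀ i j w, φ (word w) = φ' (word w) →
      φ (leftMul b i (b j) (word w)) = φ' (leftMul b i (b j) (word w))) : φ = φ' := by
  refine Finsupp.lhom_ext' fun w => LinearMap.ext_ring ?_
  change φ (word w) = φ' (word w)
  induction w with
  | nil => exact h0
  | cons p w ih => exact leftMul_basis_word b p.1 p.2 w ▸ h p.1 p.2 w ih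

theorem linearMap_end_words_ext (b : Module.Basis β k A)
    {φ φ' : A →ₗ[k] Module.End k (WordSpace k ι β)}
    (h : ∀ j w, φ (b j) (word w) = φ' (b j) (word w)) : φ = φ' :=
  b.ext fun j => Finsupp.lhom_ext' fun w => LinearMap.ext_ring (h j w)

variable (D : ChevalleyDatum k ι A T) (b : Module.Basis β k A) (χ : T →ₗ[k] k)

/-- The action of `T` on a word, dictated by `T` acting on the empty word by `χ` and by the
commutators of `t s` and `f i a`. -/
def tWord : List (ι × β) → (T →ₗ[k] WordSpace k ι β)
  | [] => χ.smulRight (word [])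
  | (i, j) :: w => leftMul b i (b j) ∘ₗ tWord w -
      (leftMul b i).flip (word w) ∘ₗ LinearMap.mulRight k (b j) ∘ₗ D.root i

/-- The linear extension of the action of `T` on words. -/
def tAction : T →ₗ[k] Module.End k (WordSpace k ι β) :=
  (Finsupp.linearCombination k (D.tWord b χ)).flip

open Classical in
/-- The action of `e i` on a word, dictated by `e i` annihilating the empty word and by the
commutators of `e i a` and `f j b`. -/
def eWord (i : ι) : List (ι × β) → (A →ₗ[k] WordSpace k ι β)
  | [] => 0
  | (j, l) :: w => leftMul b j (b l) ∘ₗ eWord i w +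
      if i = j then (D.tAction b χ).flip (word w) ∘ₗ D.coroot i ∘ₗ LinearMap.mulRight k (b l) else 0

/-- The linear extension of the action of `e i` on words. -/
def eAction (i : ι) : A →ₗ[k] Module.End k (WordSpace k ι β) :=
  (Finsupp.linearCombination k (D.eWord b χ i)).flip

theorem tAction_word (s : T) (w : List (ι × β)) :
    D.tAction b χ s (word w) = D.tWord b χ w s := by
  simp [tAction]

theorem eAction_word (i : ι) (a : A) (w : List (ι × β)) :
    D.eAction b χ i a (word w) = D.eWord b χ i w a := by
  simp [eAction]

theorem tAction_nil (s : T) : D.tAction b χ s (word []) = χ s • word [] :=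
  D.tAction_word b χ s []

theorem eAction_nil (i : ι) (a : A) : D.eAction b χ i a (word []) = 0 :=
  D.eAction_word b χ i a []

theorem tAction_leftMul (s : T) (i : ι) (a : A) (x : WordSpace k ι β) :
    D.tAction b χ s (leftMul b i a x) =
      leftMul b i a (D.tAction b χ s x) - leftMul b i (D.root i s * a) x := by
  have h : (leftMul b i).compr₂ (D.tAction b χ s) +
      leftMul b i ∘ₗ LinearMap.mulLeft k (D.root i s) = (leftMul b i).compl₂ (D.tAction b χ s) :=
    linearMap_end_words_ext b fun j w => by simp [leftMul_basis_word, tAction_word, tWord]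
  exact eq_sub_of_add_eq (LinearMap.congr_fun₂ h a x)

theorem eAction_leftMul_same (i : ι) (a c : A) (x : WordSpace k ι β) :
    D.eAction b χ i a (leftMul b i c x) =
      leftMul b i c (D.eAction b χ i a x) + D.tAction b χ (D.coroot i (a * c)) x := by
  have h : (leftMul b i).compr₂ (D.eAction b χ i a) =
      (leftMul b i).compl₂ (D.eAction b χ i a) +
        D.tAction b χ ∘ₗ D.coroot i ∘ₗ LinearMap.mulLeft k a :=
    linearMap_end_words_ext b fun j w => by simp [leftMul_basis_word, eAction_word, eWord]
  exact LinearMap.congr_fun₂ h c x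

theorem eAction_leftMul_of_ne {i j : ι} (hij : i ≠ j) (a c : A) (x : WordSpace k ι β) :
    D.eAction b χ i a (leftMul b j c x) = leftMul b j c (D.eAction b χ i a x) := by
  have h : (leftMul b j).compr₂ (D.eAction b χ i a) = (leftMul b j).compl₂ (D.eAction b χ i a) :=
    linearMap_end_words_ext b fun l w => by
      simp [leftMul_basis_word, eAction_word, eWord, if_neg hij]
  exact LinearMap.congr_fun₂ h c x

theorem tAction_mul_comm (s s' : T) :
    D.tAction b χ s * D.tAction b χ s' = D.tAction b χ s' * D.tAction b χ s := by
  refine end_words_ext b ?_ fun i j w ih => ?_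
  · simp only [Module.End.mul_apply, tAction_nil, map_smul]
    rw [smul_comm]
  · simp only [Module.End.mul_apply] at ih ⊢
    simp only [tAction_leftMul, map_sub, ih, mul_left_comm (D.root i s)]
    abel

theorem tAction_mul_eAction (s : T) (i : ι) (a : A) :
    D.tAction b χ s * D.eAction b χ i a =
      D.eAction b χ i a * D.tAction b χ s + D.eAction b χ i (D.root i s * a) := by
  refine end_words_ext b ?_ fun j l w ih => ?_
  · simp only [Module.End.mul_apply, LinearMap.add_apply, tAction_nil, eAction_nil, map_smul,
      map_zero, smul_zero, add_zero]
  · have hc := LinearMap.congr_fun (D.tAction_mul_comm b χ s (D.coroot i (a * b l))) (word w)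
    simp only [Module.End.mul_apply, LinearMap.add_apply] at ih hc ⊢
    obtain rfl | hij := eq_or_ne i j
    · simp only [tAction_leftMul, eAction_leftMul_same, map_sub, map_add, ih, hc,
        mul_left_comm a, mul_assoc]
      abel
    · simp only [tAction_leftMul, D.eAction_leftMul_of_ne b χ hij, map_sub, map_add, ih]
      abel

end

end ChevalleyDatum

namespace ChevalleyGenerators

open ChevalleyDatum

noncomputable section

section Words

variable {k ι A T β : Type*} [CommRing k] [CommRing A] [Algebra k A] [AddCommGroup T] [Module k T]
  {D : ChevalleyDatum k ι A T} {L : Type*} [LieRing L] [LieAlgebra k L]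
  (G : ChevalleyGenerators D L) (b : Module.Basis β k A) (χ : T →ₗ[k] k)

/-- The generators `G` paired with the corresponding operators on words. -/
def withWords : ChevalleyGenerators D (L × Module.End k (WordSpace k ι β)) where
  e i := (G.e i).prod (D.eAction b χ i)
  f i := (G.f i).prod (leftMul b i)
  t := G.t.prod (D.tAction b χ)
  e_f_same i a c := Prod.ext (G.e_f_same i a c) (LinearMap.ext fun x => by
    simp [LieRing.of_associative_ring_bracket, eAction_leftMul_same])
  e_f_ne i j a c hij := Prod.ext (G.e_f_ne i j a c hij) (LinearMap.ext fun x => by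
    simp [LieRing.of_associative_ring_bracket, eAction_leftMul_of_ne _ _ _ hij])
  t_e s i a := Prod.ext (G.t_e s i a) (sub_eq_of_eq_add' (D.tAction_mul_eAction b χ s i a))
  t_f s i a := Prod.ext (G.t_f s i a) (LinearMap.ext fun x => by
    simp [LieRing.of_associative_ring_bracket, tAction_leftMul])
  t_t s s' := Prod.ext (G.t_t s s') (sub_eq_zero_of_eq (D.tAction_mul_comm b χ s s'))

/-- The action of the generators `withWords` on words. -/
abbrev wordRep (L : Type*) [LieRing L] [LieAlgebra k L] (ι β : Type*) :
    L × Module.End k (WordSpace k ι β) →ₗ⁅k⁆ Module.End k (WordSpace k ι β) :=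
  LieHom.snd k L _

theorem isHighestWeight_word_nil :
    (G.withWords b χ).IsHighestWeight (wordRep L ι β) χ (word []) where
  e_eq_zero := D.eAction_nil b χ
  t_eq_smul := D.tAction_nil b χ

theorem levels_word_nil : (G.withWords b χ).levels (wordRep L ι β) (word []) = ⊤ := by
  suffices h : ∀ w, word w ∈ (G.withWords b χ).levels (wordRep L ι β) (word []) by
    rw [eq_top_iff, ← Finsupp.basisSingleOne.span_eq, Finsupp.coe_basisSingleOne]
    exact Submodule.span_le.2 (Set.range_subset_iff.2 h)
  intro w
  induction w with
  | nil => exact mem_levels _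
  | cons p w ih =>
    rw [← Prod.mk.eta (p := p), ← leftMul_basis_word b p.1 p.2 w]
    exact lowerLevels_le_levels _ (f_mem_lowerLevels (G.withWords b χ) p.1 (b p.2) ih)

theorem lowerLevels_word_nil_le :
    (G.withWords b χ).lowerLevels (wordRep L ι β) (word []) ≤
      LinearMap.ker (Finsupp.lapply []) := by
  have h (i : ι) : (leftMul b i).compr₂ (Finsupp.lapply (R := k) (M := k) []) = 0 :=
    b.ext fun j => Finsupp.lhom_ext' fun w => LinearMap.ext_ring <|
      (congrArg (fun x : WordSpace k ι β => x []) (leftMul_basis_word b i j w)).trans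
        (Finsupp.single_eq_of_ne (by simp))
  exact iSup_le fun n => (level_succ_le_iff _).2 fun i a w _ => LinearMap.congr_fun₂ (h i) a w

theorem exists_mem_generated_withWords (hgen : G.generated = ⊤) (x : L) :
    ∃ y ∈ (G.withWords b χ).generated, y.1 = x := by
  have h : G.generated ≤ (G.withWords b χ).generated.map (LieHom.fst k L _) :=
    G.generated_le_iff.2 ⟨fun i a => ⟨_, e_mem_generated _ i a, rfl⟩,
      fun i a => ⟨_, f_mem_generated _ i a, rfl⟩, fun s => ⟨_, t_mem_generated _ s, rfl⟩⟩
  exact h (hgen ▸ LieSubalgebra.mem_top x)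

theorem fst_mem_lower {y : L × Module.End k (WordSpace k ι β)}
    (hy : y ∈ (G.withWords b χ).lower) : y.1 ∈ G.lower :=
  (G.withWords b χ).lower_le_iff (P := G.lower.comap (LieHom.fst k L _)).2
    (fun i a => G.f_mem_lower i a) hy

theorem fst_mem_upper {y : L × Module.End k (WordSpace k ι β)}
    (hy : y ∈ (G.withWords b χ).upper) : y.1 ∈ G.upper :=
  (G.withWords b χ).upper_le_iff (P := G.upper.comap (LieHom.fst k L _)).2
    (fun i a => G.e_mem_upper i a) hy

end Words

section Existence

variable {k ι A T β : Type*} [Field k] [CharZero k] [CommRing A] [Algebra k A] [AddCommGroup T]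
  [Module k T] {D : ChevalleyDatum k ι A T} {L : Type*} [LieRing L] [LieAlgebra k L]
  (G : ChevalleyGenerators D L) {χ : T →ₗ[k] k} {h : T}

theorem snd_mem_lowerLevels_of_fst_eq_zero (b : Module.Basis β k A)
    (hh : D.IsGradingElement h) (hχ : ∀ s, G.t s = 0 → χ s = 0)
    {y : L × Module.End k (WordSpace k ι β)} (hy : y ∈ (G.withWords b χ).generated) (hy0 : y.1 = 0)
    (w : WordSpace k ι β) :
    y.2 w ∈ (G.withWords b χ).lowerLevels (wordRep L ι β) (word []) := by
  have hv := G.isHighestWeight_word_nil b χ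
  refine mem_lowerLevels_of_forall_lie_f_mem (G.withWords b χ) (ρ := wordRep L ι β)
    (J := {y | y ∈ (G.withWords b χ).generated ∧ y.1 = 0}) ?_ ?_ ⟨hy, hy0⟩
    (G.levels_word_nil b χ ▸ Submodule.mem_top)
  · rintro y ⟨hy, hy0⟩ i a
    refine ⟨LieSubalgebra.lie_mem _ hy (f_mem_generated _ i a), ?_⟩
    exact (congrArg (⁅·, G.f i a⁆) hy0).trans (zero_lie _)
  · rintro y ⟨hy, hy0⟩
    obtain ⟨l, hl, s, u, hu, rfl⟩ := exists_triangular_decomposition _ hy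
    have hs := hχ s (G.eq_zero_of_lower_add_t_add_pos hh (G.fst_mem_lower b χ hl)
      (G.upper_le_sumEigenspaces hh (G.fst_mem_upper b χ hu)) hy0).2
    exact hv.apply_mem_lowerLevels hl hs hu

theorem exists_isHighestWeight_ne_zero (b : Module.Basis β k A) (hgen : G.generated = ⊤)
    (hh : D.IsGradingElement h) (hχ : ∀ s, G.t s = 0 → χ s = 0) :
    ∃ (p : Submodule k (WordSpace k ι β)) (ρ : L →ₗ⁅k⁆ Module.End k (WordSpace k ι β ⧸ p))
      (v : WordSpace k ι β ⧸ p), G.IsHighestWeight ρ χ v ∧ v ≠ 0 := by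
  let S := (G.withWords b χ).generated
  let π : S →ₗ⁅k⁆ L := (LieHom.fst k L _).comp S.incl
  have hπ : Function.Surjective π := fun x =>
    let ⟨y, hy, hyx⟩ := G.exists_mem_generated_withWords b χ hgen x
    ⟨⟨y, hy⟩, hyx⟩
  obtain ⟨ρ, hρ⟩ := exists_rep_quotient_kernelImage hπ ((wordRep L ι β).comp S.incl)
  have hker : kernelImage π ((wordRep L ι β).comp S.incl) ≤ LinearMap.ker (Finsupp.lapply []) :=
    kernelImage_le_iff.2 fun y hy w => G.lowerLevels_word_nil_le b χ
      (G.snd_mem_lowerLevels_of_fst_eq_zero b hh hχ y.2 hy w)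
  refine ⟨_, ρ, Submodule.mkQ _ (word []), ⟨fun i a => ?_, fun s => ?_⟩, fun h0 => ?_⟩
  · exact (hρ ⟨_, (G.withWords b χ).e_mem_generated i a⟩ _).trans
      ((congrArg _ (D.eAction_nil b χ i a)).trans (map_zero _))
  · exact (hρ ⟨_, (G.withWords b χ).t_mem_generated s⟩ _).trans
      ((congrArg _ (D.tAction_nil b χ s)).trans (map_smul _ _ _))
  · simpa using hker ((Submodule.Quotient.mk_eq_zero _).1 h0)

end Existence

end

end ChevalleyGenerators

namespace CartanRealization

open ChevalleyGenerators

noncomputable section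

section KacMoodyGenerators

variable {ι : Type uι} [Fintype ι] {C : Matrix ι ι ℤ}
  {H : Type uH} [AddCommGroup H] [Module ℂ H] (R : CartanRealization C H)

theorem exists_root_eq_one : ∃ h : H, ∀ i, R.root i h = 1 := by
  have := R.finiteDimensional
  let b := Module.Basis.span R.linearIndependent_root
  obtain ⟨φ, hφ⟩ := LinearMap.exists_extend (b.constr ℂ fun _ => (1 : ℂ))
  have hroot (i : ι) : φ (R.root i) = 1 :=
    calc φ (R.root i) = φ (b i) :=
          congrArg (φ ∘ Subtype.val) (Module.Basis.span_apply R.linearIndependent_root i).symm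
      _ = b.constr ℂ (fun _ => (1 : ℂ)) (b i) := LinearMap.congr_fun hφ (b i)
      _ = 1 := b.constr_basis ℂ _ i
  exact ⟨(Module.evalEquiv ℂ H).symm φ, fun i => by simp [hroot]⟩

/-- The projection of the free Lie algebra to the Kac-Moody algebra. -/
def freeToKacMoody : FreeLieAlgebra ℂ (Gen ι H) →ₗ⁅ℂ⁆ R.KacMoody where
  toFun x := LieSubmodule.Quotient.mk (N := R.radIdeal)
    (LieSubmodule.Quotient.mk (N := R.relIdeal) x)
  map_add' _ _ := rfl
  map_smul' _ _ := rfl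
  map_lie' := rfl

theorem freeToKacMoody_surjective : Function.Surjective R.freeToKacMoody :=
  (LieSubmodule.Quotient.surjective_mk' R.radIdeal).comp
    (LieSubmodule.Quotient.surjective_mk' R.relIdeal)

theorem freeToKacMoody_eq_zero {x : FreeLieAlgebra ℂ (Gen ι H)} (hx : AuxRel R x) :
    R.freeToKacMoody x = 0 := by
  have h : (LieSubmodule.Quotient.mk x : R.Aux) = 0 :=
    (LieSubmodule.Quotient.mk_eq_zero' ..).2 (LieSubmodule.subset_lieSpan hx)
  exact congrArg (LieSubmodule.Quotient.mk (N := R.radIdeal)) h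

theorem freeToKacMoody_genH (x : H) : R.freeToKacMoody (genH ι x) = R.toKacMoody x := rfl

/-- The simple roots and coroots of a realization. -/
def chevalleyDatum : ChevalleyDatum ℂ ι ℂ H where
  root := R.root
  coroot i := LinearMap.toSpanSingleton ℂ H (R.coroot i)

/-- The Chevalley generators of the Kac-Moody algebra. -/
def generators : ChevalleyGenerators R.chevalleyDatum R.KacMoody where
  e i := LinearMap.toSpanSingleton ℂ _ (R.freeToKacMoody (genE H i))
  f i := LinearMap.toSpanSingleton ℂ _ (R.freeToKacMoody (genF H i))
  t := R.toKacMoody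
  e_f_same i a b := by
    have h := R.freeToKacMoody_eq_zero (AuxRel.e_f_same i)
    rw [map_sub, LieHom.map_lie, sub_eq_zero, freeToKacMoody_genH] at h
    simp [chevalleyDatum, h, smul_smul, mul_comm]
  e_f_ne i j a b hij := by
    have h := R.freeToKacMoody_eq_zero (AuxRel.e_f_ne i j hij)
    rw [LieHom.map_lie] at h
    simp [h]
  t_e s i a := by
    have h := R.freeToKacMoody_eq_zero (AuxRel.h_e s i)
    rw [map_sub, LieHom.map_lie, sub_eq_zero, freeToKacMoody_genH, map_smul] at h
    simp [chevalleyDatum, h, smul_smul, mul_comm]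
  t_f s i a := by
    have h := R.freeToKacMoody_eq_zero (AuxRel.h_f s i)
    rw [map_add, LieHom.map_lie, freeToKacMoody_genH, map_smul] at h
    simp [chevalleyDatum, eq_neg_of_add_eq_zero_left h, smul_smul, mul_comm]
  t_t s s' := by
    have h := R.freeToKacMoody_eq_zero (AuxRel.h_h s s')
    rwa [LieHom.map_lie, freeToKacMoody_genH, freeToKacMoody_genH] at h

theorem lie_toKacMoody_e (h : H) (i : ι) :
    ⁅R.toKacMoody h, R.generators.e i 1⁆ = R.root i h • R.generators.e i 1 := by
  rw [← map_smul, smul_eq_mul]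
  exact R.generators.t_e h i 1

theorem lie_toKacMoody_f (h : H) (i : ι) :
    ⁅R.toKacMoody h, R.generators.f i 1⁆ = (-R.root i) h • R.generators.f i 1 := by
  rw [LinearMap.neg_apply, neg_smul, ← map_smul, smul_eq_mul]
  exact R.generators.t_f h i 1

theorem lie_e_f_same (i : ι) :
    ⁅R.generators.e i 1, R.generators.f i 1⁆ = R.toKacMoody (R.coroot i) := by
  rw [R.generators.e_f_same, mul_one]
  exact congrArg R.toKacMoody (one_smul ℂ (R.coroot i))

theorem generated_generators : R.generators.generated = ⊤ := by
  let g : Gen ι H → R.generators.generated := fun x => match x with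
    | .e i => ⟨_, R.generators.e_mem_generated i 1⟩
    | .f i => ⟨_, R.generators.f_mem_generated i 1⟩
    | .h x => ⟨_, R.generators.t_mem_generated x⟩
  have h : (R.generators.generated.incl).comp (FreeLieAlgebra.lift ℂ g) = R.freeToKacMoody := by
    refine FreeLieAlgebra.hom_ext fun x => ?_
    rw [LieHom.comp_apply, FreeLieAlgebra.lift_of_apply]
    cases x with
    | e i => exact one_smul ℂ (R.freeToKacMoody (genE H i))
    | f i => exact one_smul ℂ (R.freeToKacMoody (genF H i))
    | h x => rfl
  refine eq_top_iff.2 fun x _ => ?_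
  obtain ⟨y, rfl⟩ := R.freeToKacMoody_surjective x
  rw [← h]
  exact (FreeLieAlgebra.lift ℂ g y).2

theorem mem_generated (x : R.KacMoody) : x ∈ R.generators.generated :=
  R.generated_generators ▸ LieSubalgebra.mem_top x

theorem generators_e_eq_smul (i : ι) (c : ℂ) : R.generators.e i c = c • R.generators.e i 1 := by
  rw [← map_smul, smul_eq_mul, mul_one]

theorem generators_f_eq_smul (i : ι) (c : ℂ) : R.generators.f i c = c • R.generators.f i 1 := by
  rw [← map_smul, smul_eq_mul, mul_one]

theorem lie_mem_derived (x y : R.KacMoody) : ⁅x, y⁆ ∈ R.derived :=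
  LieSubmodule.lie_mem_lie (LieSubmodule.mem_top x) (LieSubmodule.mem_top y)

theorem e_mem_derived (i : ι) : R.generators.e i 1 ∈ R.derived := by
  obtain ⟨h, hh⟩ := R.exists_root_eq_one
  have he := R.lie_toKacMoody_e h i
  rw [hh i, one_smul] at he
  exact he ▸ R.lie_mem_derived _ _

theorem f_mem_derived (i : ι) : R.generators.f i 1 ∈ R.derived := by
  obtain ⟨h, hh⟩ := R.exists_root_eq_one
  have hf := R.lie_toKacMoody_f h i
  rw [LinearMap.neg_apply, hh i, neg_smul, one_smul] at hf
  exact neg_mem_iff.1 (hf ▸ R.lie_mem_derived _ _)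

theorem coroot_mem_derived (i : ι) : R.toKacMoody (R.coroot i) ∈ R.derived :=
  R.lie_e_f_same i ▸ R.lie_mem_derived _ _

/-- The element `e i` of `g'`. -/
def eDerived (i : ι) : R.derived := ⟨R.generators.e i 1, R.e_mem_derived i⟩

/-- The element `f i` of `g'`. -/
def fDerived (i : ι) : R.derived := ⟨R.generators.f i 1, R.f_mem_derived i⟩

/-- The simple coroots, as elements of `h'`. -/
def corootDerived (i : ι) : R.cartanDerived :=
  ⟨⟨R.toKacMoody (R.coroot i), R.coroot_mem_derived i⟩, ⟨R.coroot i, rfl⟩⟩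

theorem lie_eDerived_fDerived_same (i : ι) :
    ⁅R.eDerived i, R.fDerived i⁆ = (R.corootDerived i : R.derived) :=
  Subtype.ext (R.lie_e_f_same i)

theorem lie_eDerived_fDerived_ne {i j : ι} (hij : i ≠ j) : ⁅R.eDerived i, R.fDerived j⁆ = 0 :=
  Subtype.ext (R.generators.e_f_ne i j 1 1 hij)

theorem derived_le_triangular :
    R.derived.toSubmodule ≤ R.generators.triangular R.chevalleyDatum.corootSpan := by
  rw [derived, LieSubmodule.lieIdeal_oper_eq_linear_span', Submodule.span_le]
  rintro _ ⟨x, -, y, -, rfl⟩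
  exact R.generators.lie_mem_triangular_corootSpan (R.mem_generated x) (R.mem_generated y)

theorem lower_le_derived : R.generators.lower ≤ LieIdeal.toLieSubalgebra ℂ _ R.derived :=
  R.generators.lower_le_iff.2 fun i c =>
    R.generators_f_eq_smul i c ▸ R.derived.smul_mem c (R.f_mem_derived i)

theorem upper_le_derived : R.generators.upper ≤ LieIdeal.toLieSubalgebra ℂ _ R.derived :=
  R.generators.upper_le_iff.2 fun i c =>
    R.generators_e_eq_smul i c ▸ R.derived.smul_mem c (R.e_mem_derived i)

theorem exists_derived_decomposition (x : R.derived) :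
    ∃ (y : R.derived) (s : R.cartanDerived) (z : R.derived),
      (y : R.KacMoody) ∈ R.generators.lower ∧ (z : R.KacMoody) ∈ R.generators.upper ∧
        y + s + z = x := by
  obtain ⟨y, hy, s, -, z, hz, h⟩ := mem_triangular.1 (R.derived_le_triangular x.2)
  have hs : R.toKacMoody s = x - y - z := by
    rw [← h, sub_sub, add_right_comm, add_sub_cancel_left]
    rfl
  have hs' : R.toKacMoody s ∈ R.derived := hs ▸
    sub_mem (sub_mem x.2 (R.lower_le_derived hy)) (R.upper_le_derived hz)
  exact ⟨⟨y, R.lower_le_derived hy⟩, ⟨⟨_, hs'⟩, ⟨s, rfl⟩⟩, ⟨z, R.upper_le_derived hz⟩, hy, hz,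
    Subtype.ext h⟩

theorem exists_toKacMoody_corootSpan_eq (x : R.cartanDerived) :
    ∃ s ∈ R.chevalleyDatum.corootSpan, R.toKacMoody s = ((x : R.derived) : R.KacMoody) := by
  obtain ⟨h, hh⟩ := R.exists_root_eq_one
  obtain ⟨s', hs'⟩ : ((x : R.derived) : R.KacMoody) ∈ R.cartan := x.2
  obtain ⟨y, hy, s, hs, z, hz, hx⟩ := mem_triangular.1 (R.derived_le_triangular x.1.2)
  obtain ⟨-, h0⟩ := R.generators.eq_zero_of_lower_add_t_add_pos hh (s := s - s') hy
    (R.generators.upper_le_sumEigenspaces hh hz) (by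
      rw [map_sub, show R.generators.t s' = _ from hs', ← hx]; abel)
  rw [map_sub, sub_eq_zero] at h0
  exact ⟨s, hs, h0.trans hs'⟩

theorem span_range_corootDerived : Submodule.span ℂ (Set.range R.corootDerived) = ⊤ := by
  refine eq_top_iff.2 fun x _ => ?_
  obtain ⟨s, hs, hsx⟩ := R.exists_toKacMoody_corootSpan_eq x
  have hle : R.chevalleyDatum.corootSpan ≤ ((Submodule.span ℂ (Set.range R.corootDerived)).map
      (R.derived.toSubmodule.subtype ∘ₗ R.cartanDerived.subtype)).comap R.toKacMoody := by
    refine iSup_le fun i => ?_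
    rintro _ ⟨c, rfl⟩
    exact ⟨c • R.corootDerived i, Submodule.smul_mem _ c (Submodule.subset_span ⟨i, rfl⟩),
      (map_smul R.toKacMoody c (R.coroot i)).symm⟩
  obtain ⟨u, hu, hus⟩ := hle hs
  rwa [show x = u from Subtype.ext (Subtype.ext (hsx.symm.trans hus.symm))]

theorem nPos_le_sumEigenspaces {h : H} (hh : ∀ i, R.root i h = 1) {x : R.derived}
    (hx : x ∈ R.nPos) : (x : R.KacMoody) ∈
      sumEigenspaces (LieAlgebra.ad ℂ _ (R.generators.t h)) (Int.cast '' Set.Ioi 0) := by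
  refine (iSup_le fun n => ?_ : (⨆ n : {n : ι → ℕ // n ≠ 0},
    R.rootSpace (∑ i, n.1 i • R.root i)) ≤ _) hx
  refine le_trans (fun y hy => ?_)
    (eigenspace_le_sumEigenspaces _ (μ := ((∑ i, n.1 i : ℕ) : ℂ)) ?_)
  · rw [Module.End.mem_eigenspace_iff, LieAlgebra.ad_apply]
    refine (hy h).trans ?_
    simp [hh]
  · have hn : ∑ i, n.1 i ≠ 0 := fun h0 => n.2 (funext fun i =>
      (Finset.sum_eq_zero_iff.1 h0) i (Finset.mem_univ i))
    exact ⟨(∑ i, n.1 i : ℕ), Set.mem_Ioi.2 (by exact_mod_cast hn.bot_lt), Int.cast_natCast _⟩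

theorem mem_upper_of_mem_nPos {x : R.derived} (hx : x ∈ R.nPos) :
    (x : R.KacMoody) ∈ R.generators.upper := by
  obtain ⟨h, hh⟩ := R.exists_root_eq_one
  obtain ⟨y, hy, s, z, hz, hxyz⟩ := R.generators.exists_triangular_decomposition
    (R.mem_generated (x : R.KacMoody))
  obtain ⟨hy0, hs0⟩ := R.generators.eq_zero_of_lower_add_t_add_pos hh (s := s) hy
    (sub_mem (R.generators.upper_le_sumEigenspaces hh hz) (R.nPos_le_sumEigenspaces hh hx))
    (by rw [← hxyz]; abel)
  rw [hy0, hs0, zero_add, zero_add] at hxyz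
  exact hxyz ▸ hz

theorem eDerived_mem_nPos (i : ι) : R.eDerived i ∈ R.nPos := by
  classical
  refine Submodule.mem_iSup_of_mem (p := fun n : {n : ι → ℕ // n ≠ 0} =>
    R.rootSpace (∑ i, n.1 i • R.root i)) ⟨Pi.single i 1, by simp⟩ fun h => ?_
  have hroot : ∑ j, (Pi.single i 1 : ι → ℕ) j • R.root j = R.root i := by
    rw [Finset.sum_eq_single i] <;> simp +contextual
  exact (R.lie_toKacMoody_e h i).trans (congrArg (fun μ => μ h • _) hroot.symm)

end KacMoodyGenerators

section Complement

variable {ι : Type uι} [Fintype ι] {C : Matrix ι ι ℤ}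
  {H : Type uH} [AddCommGroup H] [Module ℂ H] {R : CartanRealization C H}
  {K : LieSubalgebra ℂ R.KacMoody}

variable (K) in
/-- The sum map `h' × h'' → g`. -/
def addMap : R.cartanDerived × K →ₗ[ℂ] R.KacMoody :=
  (R.derived.toSubmodule.subtype ∘ₗ R.cartanDerived.subtype).coprod K.toSubmodule.subtype

theorem addMap_injective (hK : R.IsComplement K) : Function.Injective (addMap K) := by
  refine (injective_iff_map_eq_zero _).2 fun ⟨x, y⟩ h => ?_
  have h : ((x : R.derived) : R.KacMoody) + (y : R.KacMoody) = 0 := h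
  have hy : (y : R.KacMoody) = 0 := by
    have hmem : (y : R.KacMoody) ∈ (R.cartan ⊓ R.derived.toSubmodule) ⊓ K.toSubmodule := by
      refine ⟨?_, y.2⟩
      rw [eq_neg_of_add_eq_zero_right h]
      exact neg_mem ⟨x.2, x.1.2⟩
    rwa [hK.disjoint, Submodule.mem_bot] at hmem
  rw [hy, add_zero] at h
  exact Prod.ext (Subtype.ext (Subtype.ext h)) (Subtype.ext hy)

theorem toKacMoody_mem_range_addMap (hK : R.IsComplement K) (h : H) :
    R.toKacMoody h ∈ LinearMap.range (addMap K) := by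
  have hmem : R.toKacMoody h ∈ R.cartan := ⟨h, rfl⟩
  rw [← hK.sup_eq] at hmem
  obtain ⟨x, hx, y, hy, hxy⟩ := Submodule.mem_sup.1 hmem
  exact ⟨(⟨⟨x, hx.2⟩, hx.1⟩, ⟨y, hy⟩), hxy⟩

theorem mem_cartan_of_mem (hK : R.IsComplement K) (y : K) : (y : R.KacMoody) ∈ R.cartan :=
  hK.sup_eq ▸ Submodule.mem_sup_right y.2

/-- The decomposition of elements of `H` according to `h = h' ⊕ h''`. -/
def split (hK : R.IsComplement K) : H →ₗ[ℂ] R.cartanDerived × K :=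
  (LinearEquiv.ofInjective (addMap K) (addMap_injective hK)).symm.toLinearMap ∘ₗ
    R.toKacMoody.codRestrict _ (toKacMoody_mem_range_addMap hK)

theorem addMap_split (hK : R.IsComplement K) (h : H) :
    addMap K (split hK h) = R.toKacMoody h :=
  congrArg Subtype.val
    ((LinearEquiv.ofInjective (addMap K) (addMap_injective hK)).apply_symm_apply
      (R.toKacMoody.codRestrict _ (toKacMoody_mem_range_addMap hK) h))

theorem split_eq (hK : R.IsComplement K) {h : H} {x : R.cartanDerived × K}
    (hx : addMap K x = R.toKacMoody h) : split hK h = x :=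
  addMap_injective hK ((addMap_split hK h).trans hx.symm)

end Complement

end

end CartanRealization

section TensorProd

theorem eq_top_of_tmul_mem_of_mem {k M N P : Type*} [CommRing k] [AddCommGroup M] [Module k M]
    [AddCommGroup N] [Module k N] [AddCommGroup P] [Module k P] {p : Submodule k ((M ⊗[k] N) × P)}
    (hMN : ∀ m n, (m ⊗ₜ[k] n, 0) ∈ p) (hP : ∀ x, (0, x) ∈ p) : p = ⊤ := by
  have hleft : ⊤ ≤ p.comap (LinearMap.inl k (M ⊗[k] N) P) := by
    rw [← TensorProduct.span_tmul_eq_top, Submodule.span_le]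
    rintro _ ⟨m, n, rfl⟩
    exact hMN m n
  refine eq_top_iff.2 fun ⟨u, x⟩ _ => ?_
  have hu : (u, 0) ∈ p := hleft Submodule.mem_top
  simpa using add_mem hu (hP x)

end TensorProd

namespace CartanRealization

open ChevalleyGenerators

noncomputable section

variable {ι : Type uι} [Fintype ι] {C : Matrix ι ι ℤ}
  {H : Type uH} [AddCommGroup H] [Module ℂ H] {R : CartanRealization C H}
  {K : LieSubalgebra ℂ R.KacMoody} {A : Type uA} [CommRing A] [Algebra ℂ A]

section CurrentAlgebra

variable (K) in
/-- The element `a ⊗ x` of the current algebra, linear in both arguments. -/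
def tmulCurrent : A →ₗ[ℂ] R.derived →ₗ[ℂ] R.Current A K :=
  (TensorProduct.mk ℂ A R.derived).compr₂
    (LieAlgebra.SemiDirectSum.inl (R.currentAction A K)).toLinearMap

theorem tmulCurrent_apply (a : A) (x : R.derived) :
    tmulCurrent K a x = (⟨a ⊗ₜ[ℂ] x, 0⟩ : R.Current A K) := rfl

theorem lie_tmulCurrent (a b : A) (x y : R.derived) :
    ⁅tmulCurrent K a x, tmulCurrent K b y⁆ = tmulCurrent K (a * b) ⁅x, y⁆ := by
  simp [tmulCurrent_apply, LieAlgebra.ExtendScalars.bracket_tmul]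

variable (K A) in
/-- The inclusion of `(A ⊗ h') ⊕ h''` in the current algebra as a linear map. -/
def currentCartanMap : (A ⊗[ℂ] R.cartanDerived) × K →ₗ[ℂ] R.Current A K :=
  (LieAlgebra.SemiDirectSum.toProdl (R.currentAction A K)).symm.toLinearMap ∘ₗ
    (R.cartanDerived.subtype.lTensor A).prodMap LinearMap.id

theorem currentCartanMap_apply (t : (A ⊗[ℂ] R.cartanDerived) × K) :
    currentCartanMap K A t = R.currentCartan A K t := rfl

theorem currentCartanMap_injective : Function.Injective (currentCartanMap K A) :=
  (LieAlgebra.SemiDirectSum.toProdl (R.currentAction A K)).symm.injective.comp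
    ((Module.Flat.lTensor_preserves_injective_linearMap R.cartanDerived.subtype
      Subtype.val_injective).prodMap Function.injective_id)

theorem currentCartanMap_tmul (a : A) (x : R.cartanDerived) :
    currentCartanMap K A (a ⊗ₜ[ℂ] x, 0) = tmulCurrent K a (x : R.derived) := rfl

theorem eq_top_of_tmulCurrent_mem {p : Submodule ℂ (R.Current A K)}
    (htmul : ∀ a x, tmulCurrent K a x ∈ p) (hK : ∀ k, currentCartanMap K A (0, k) ∈ p) :
    p = ⊤ := by
  have htop : p.comap (LieAlgebra.SemiDirectSum.toProdl (R.currentAction A K)).symm.toLinearMap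
      = ⊤ :=
    eq_top_of_tmul_mem_of_mem htmul fun k => by
      simpa [currentCartanMap] using hK k
  refine eq_top_iff.2 fun z _ => ?_
  exact (htop ▸ Submodule.mem_top :
    LieAlgebra.SemiDirectSum.toProdl (R.currentAction A K) z ∈ _)

theorem lie_currentCartanMap_tmulCurrent (k : K) (a : A) (x : R.derived) :
    ⁅currentCartanMap K A (0, k), tmulCurrent K a x⁆ = tmulCurrent K a ⁅(k : R.KacMoody), x⁆ := by
  rw [currentCartanMap_apply, currentCartan, tmulCurrent_apply, tmulCurrent_apply,
    LieAlgebra.SemiDirectSum.lie_eq_mk]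
  simp [currentAction, LieIdeal.adDerivation]
  rfl

theorem lie_eq_zero_of_mem_cartan {x y : R.KacMoody} (hx : x ∈ R.cartan) (hy : y ∈ R.cartan) :
    ⁅x, y⁆ = 0 := by
  obtain ⟨s, rfl⟩ := hx
  obtain ⟨s', rfl⟩ := hy
  exact R.generators.t_t s s'

theorem lie_cartanDerived_eq_zero {x : R.KacMoody} (hx : x ∈ R.cartan) (y : R.cartanDerived) :
    ⁅x, (y : R.derived)⁆ = 0 :=
  Subtype.ext (lie_eq_zero_of_mem_cartan hx y.2)

theorem lie_currentCartanMap_eq_zero_of {z : R.Current A K}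
    (htmul : ∀ (a : A) (x : R.cartanDerived), ⁅tmulCurrent K a (x : R.derived), z⁆ = 0)
    (hK : ∀ k : K, ⁅currentCartanMap K A (0, k), z⁆ = 0) (t) : ⁅currentCartanMap K A t, z⁆ = 0 := by
  have htop : LinearMap.ker (LieAlgebra.ad ℂ _ z ∘ₗ currentCartanMap K A) = ⊤ :=
    eq_top_of_tmul_mem_of_mem
      (fun a x => by
        rw [LinearMap.mem_ker, LinearMap.comp_apply, currentCartanMap_tmul]
        exact (lie_skew _ _).symm.trans (neg_eq_zero.2 (htmul a x)))
      fun k => (lie_skew _ _).symm.trans (neg_eq_zero.2 (hK k))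
  have hz : ⁅z, currentCartanMap K A t⁆ = 0 := LinearMap.congr_fun (LinearMap.ker_eq_top.1 htop) t
  rw [← lie_skew, hz, neg_zero]

theorem lie_currentCartanMap (hK : R.IsComplement K) (s t) :
    ⁅currentCartanMap K A s, currentCartanMap K A t⁆ = 0 := by
  have hKK (k l : K) : ⁅currentCartanMap K A (0, k), currentCartanMap K A (0, l)⁆ = 0 := by
    have hkl : ⁅k, l⁆ = 0 := Subtype.ext
      (lie_eq_zero_of_mem_cartan (mem_cartan_of_mem hK k) (mem_cartan_of_mem hK l))
    simp [currentCartanMap_apply, currentCartan, hkl]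
  have hKtmul (k : K) (a : A) (x : R.cartanDerived) :
      ⁅currentCartanMap K A (0, k), tmulCurrent K a (x : R.derived)⁆ = 0 := by
    rw [lie_currentCartanMap_tmulCurrent, lie_cartanDerived_eq_zero (mem_cartan_of_mem hK k),
      map_zero]
  refine lie_currentCartanMap_eq_zero_of (fun a x => ?_) (fun k => ?_) s <;>
    rw [← lie_skew, neg_eq_zero]
  · refine lie_currentCartanMap_eq_zero_of (fun b y => ?_) (fun k => hKtmul k a x) t
    rw [lie_tmulCurrent, show ⁅(y : R.derived), (x : R.derived)⁆ = 0 from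
      lie_cartanDerived_eq_zero y.2 x, map_zero]
  · refine lie_currentCartanMap_eq_zero_of (fun b y => ?_) (fun l => hKK l k) t
    rw [← lie_skew, hKtmul, neg_zero]

end CurrentAlgebra

section CurrentGenerators

variable (R A) in
/-- The roots and coroots of the current algebra, on `(ι → A) × H` in place of `(A ⊗ h') ⊕ h''`:
the point `(y, h)` stands for `∑ j, yⱼ ⊗ αⱼ^∨ + h`. -/
def currentDatum : ChevalleyDatum ℂ ι A ((ι → A) × H) where
  root i := (∑ j, R.root i (R.coroot j) • LinearMap.proj j).coprod
    (Algebra.linearMap ℂ A ∘ₗ R.root i)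
  coroot i := by
    classical exact LinearMap.inl ℂ _ _ ∘ₗ LinearMap.single ℂ (fun _ : ι => A) i

theorem currentDatum_root (i : ι) (s : (ι → A) × H) : (R.currentDatum A).root i s =
    ∑ j, R.root i (R.coroot j) • s.1 j + algebraMap ℂ A (R.root i s.2) := by
  simp [currentDatum, LinearMap.sum_apply]

theorem exists_isGradingElement_currentDatum :
    ∃ h, (R.currentDatum A).IsGradingElement (0, h) := by
  obtain ⟨h, hh⟩ := R.exists_root_eq_one
  exact ⟨h, fun i => by simp [currentDatum_root, hh]⟩

variable (A) in
/-- The map `(ι → A) × H → (A ⊗ h') × h''` sending `(y, h)` to `∑ j, yⱼ ⊗ αⱼ^∨ + h`. -/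
def toCartanPair (hK : R.IsComplement K) : (ι → A) × H →ₗ[ℂ] (A ⊗[ℂ] R.cartanDerived) × K :=
  (LinearMap.inl ℂ _ _ ∘ₗ
      ∑ j, (TensorProduct.mk ℂ A R.cartanDerived).flip (R.corootDerived j) ∘ₗ
        LinearMap.proj j).coprod
    ((TensorProduct.mk ℂ A R.cartanDerived 1).prodMap LinearMap.id ∘ₗ split hK)

theorem toCartanPair_apply (hK : R.IsComplement K) (s : (ι → A) × H) :
    toCartanPair A hK s = ∑ j, (s.1 j ⊗ₜ[ℂ] R.corootDerived j, (0 : K)) +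
      (1 ⊗ₜ[ℂ] (split hK s.2).1, (split hK s.2).2) := by
  ext <;> simp [toCartanPair, Prod.fst_sum, Prod.snd_sum]

theorem toCartanPair_single [DecidableEq ι] (hK : R.IsComplement K) (i : ι) (a : A) :
    toCartanPair A hK (Pi.single i a, 0) = (a ⊗ₜ[ℂ] R.corootDerived i, 0) := by
  rw [toCartanPair_apply, Finset.sum_eq_single i] <;> simp +contextual

theorem toCartanPair_surjective (hK : R.IsComplement K) :
    Function.Surjective (toCartanPair A hK) := by
  classical
  refine LinearMap.range_eq_top.1 (eq_top_of_tmul_mem_of_mem (fun a x => ?_) fun k => ?_)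
  · have hspan : ⊤ ≤ (LinearMap.range (toCartanPair A hK)).comap
        (LinearMap.inl ℂ _ _ ∘ₗ TensorProduct.mk ℂ A R.cartanDerived a) := by
      rw [← R.span_range_corootDerived, Submodule.span_le]
      rintro _ ⟨i, rfl⟩
      exact ⟨(Pi.single i a, 0), toCartanPair_single hK i a⟩
    exact hspan (Submodule.mem_top (x := x))
  · obtain ⟨h, hh⟩ := mem_cartan_of_mem hK k
    have hsplit : split hK h = (0, k) := split_eq hK (by rw [hh]; simp [addMap]; rfl)
    exact ⟨(0, h), by simp [toCartanPair_apply, hsplit]⟩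

theorem lie_split_tmulCurrent (hK : R.IsComplement K) {x : R.derived} {h : H} {c : ℂ}
    (hx : ⁅R.toKacMoody h, (x : R.KacMoody)⁆ = c • (x : R.KacMoody)) (a : A) :
    ⁅currentCartanMap K A (1 ⊗ₜ[ℂ] (split hK h).1, (split hK h).2), tmulCurrent K a x⁆ =
      c • tmulCurrent K a x := by
  have hsum : ⁅((split hK h).1 : R.derived), x⁆ + ⁅((split hK h).2 : R.KacMoody), x⁆ = c • x := by
    refine Subtype.ext (Eq.trans ?_ hx)
    rw [← addMap_split hK h]
    exact (add_lie _ _ _).symm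
  rw [← Prod.fst_add_snd (1 ⊗ₜ[ℂ] (split hK h).1, (split hK h).2), map_add, add_lie,
    currentCartanMap_tmul, lie_tmulCurrent, one_mul, lie_currentCartanMap_tmulCurrent, ← map_add,
    hsum, map_smul]

theorem lie_toCartanPair_tmulCurrent (hK : R.IsComplement K) {x : R.derived}
    {μ : Module.Dual ℂ H}
    (hx : ∀ h, ⁅R.toKacMoody h, (x : R.KacMoody)⁆ = μ h • (x : R.KacMoody))
    (s : (ι → A) × H) (a : A) :
    ⁅currentCartanMap K A (toCartanPair A hK s), tmulCurrent K a x⁆ =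
      tmulCurrent K ((∑ j, μ (R.coroot j) • s.1 j + algebraMap ℂ A (μ s.2)) * a) x := by
  have hcoroot (j : ι) : ⁅currentCartanMap K A (s.1 j ⊗ₜ[ℂ] R.corootDerived j, 0),
      tmulCurrent K a x⁆ = tmulCurrent K ((μ (R.coroot j) • s.1 j) * a) x := by
    rw [currentCartanMap_tmul, lie_tmulCurrent, show ⁅(R.corootDerived j : R.derived), x⁆ =
      μ (R.coroot j) • x from Subtype.ext (hx _), map_smul, smul_mul_assoc, map_smul,
      LinearMap.smul_apply]
  rw [toCartanPair_apply, map_add, map_sum, add_lie, sum_lie,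
    Finset.sum_congr rfl fun j _ => hcoroot j, lie_split_tmulCurrent hK (hx _), add_mul,
    Finset.sum_mul, ← Algebra.smul_def]
  simp only [map_add, map_sum, map_smul, LinearMap.add_apply, LinearMap.sum_apply,
    LinearMap.smul_apply]

variable (A) in
/-- The Chevalley generators `e i ⊗ a`, `f i ⊗ a` of the current algebra. -/
def currentGenerators (hK : R.IsComplement K) :
    ChevalleyGenerators (R.currentDatum A) (R.Current A K) where
  e i := (tmulCurrent K).flip (R.eDerived i)
  f i := (tmulCurrent K).flip (R.fDerived i)
  t := currentCartanMap K A ∘ₗ toCartanPair A hK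
  e_f_same i a b := by
    classical
    rw [LinearMap.flip_apply, LinearMap.flip_apply, lie_tmulCurrent, lie_eDerived_fDerived_same,
      ← currentCartanMap_tmul]
    exact congrArg (currentCartanMap K A) (toCartanPair_single hK i (a * b)).symm
  e_f_ne i j a b hij := by
    rw [LinearMap.flip_apply, LinearMap.flip_apply, lie_tmulCurrent,
      R.lie_eDerived_fDerived_ne hij, map_zero]
  t_e s i a := by
    rw [currentDatum_root]
    exact lie_toCartanPair_tmulCurrent hK (fun h => R.lie_toKacMoody_e h i) s a
  t_f s i a := by
    refine (lie_toCartanPair_tmulCurrent hK (fun h => R.lie_toKacMoody_f h i) s a).trans ?_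
    have hneg : ∑ j, (-R.root i) (R.coroot j) • s.1 j + algebraMap ℂ A ((-R.root i) s.2) =
        -(R.currentDatum A).root i s := by
      rw [currentDatum_root]
      simp only [LinearMap.neg_apply, neg_smul, Finset.sum_neg_distrib, map_neg, neg_add]
    rw [hneg, neg_mul, map_neg, LinearMap.neg_apply]
    rfl
  t_t s s' := lie_currentCartanMap hK _ _

theorem currentGenerators_t (hK : R.IsComplement K) (s : (ι → A) × H) :
    (currentGenerators A hK).t s = R.currentCartan A K (toCartanPair A hK s) := rfl

/-- The subalgebra of all `x ∈ g'` such that all `x ⊗ a` are in `Q`. -/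
def tensorSubalgebra (Q : LieSubalgebra ℂ (R.Current A K)) : LieSubalgebra ℂ R.derived where
  __ := ⨅ a, Q.toSubmodule.comap (tmulCurrent K a)
  lie_mem' {x y} hx hy := by
    simp only [AddSubsemigroup.mem_carrier, AddSubmonoid.mem_toSubsemigroup,
      Submodule.mem_toAddSubmonoid, Submodule.mem_iInf, Submodule.mem_comap] at hx hy ⊢
    intro a
    have h := Q.lie_mem (hx a) (hy 1)
    rwa [lie_tmulCurrent, mul_one] at h

theorem mem_tensorSubalgebra {Q : LieSubalgebra ℂ (R.Current A K)} {x : R.derived} :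
    x ∈ tensorSubalgebra Q ↔ ∀ a, tmulCurrent K a x ∈ Q :=
  Submodule.mem_iInf _

theorem tmulCurrent_mem_upper (hK : R.IsComplement K) {x : R.derived}
    (hx : (x : R.KacMoody) ∈ R.generators.upper) (a : A) :
    tmulCurrent K a x ∈ (currentGenerators A hK).upper := by
  have hle : R.generators.upper ≤
      (tensorSubalgebra (currentGenerators A hK).upper).map R.derived.incl := by
    refine R.generators.upper_le_iff.2 fun i c => ⟨c • R.eDerived i, ?_, ?_⟩
    · exact Submodule.smul_mem _ c (mem_tensorSubalgebra.2 fun a =>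
        (currentGenerators A hK).e_mem_upper i a)
    · exact (R.generators_e_eq_smul i c).symm
  obtain ⟨y, hy, hyx⟩ := hle hx
  rw [← Subtype.ext (a1 := y) (a2 := x) hyx]
  exact mem_tensorSubalgebra.1 hy a

theorem tmulCurrent_mem_lower (hK : R.IsComplement K) {x : R.derived}
    (hx : (x : R.KacMoody) ∈ R.generators.lower) (a : A) :
    tmulCurrent K a x ∈ (currentGenerators A hK).lower := by
  have hle : R.generators.lower ≤
      (tensorSubalgebra (currentGenerators A hK).lower).map R.derived.incl := by
    refine R.generators.lower_le_iff.2 fun i c => ⟨c • R.fDerived i, ?_, ?_⟩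
    · exact Submodule.smul_mem _ c (mem_tensorSubalgebra.2 fun a =>
        (currentGenerators A hK).f_mem_lower i a)
    · exact (R.generators_f_eq_smul i c).symm
  obtain ⟨y, hy, hyx⟩ := hle hx
  rw [← Subtype.ext (a1 := y) (a2 := x) hyx]
  exact mem_tensorSubalgebra.1 hy a

theorem generated_currentGenerators (hK : R.IsComplement K) :
    (currentGenerators A hK).generated = ⊤ := by
  have hcartan (t) : currentCartanMap K A t ∈ (currentGenerators A hK).generated := by
    obtain ⟨s, rfl⟩ := toCartanPair_surjective hK t
    exact (currentGenerators A hK).t_mem_generated s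
  refine (LieSubalgebra.toSubmodule_inj _ _).1 (eq_top_of_tmulCurrent_mem (fun a x => ?_)
    fun k => hcartan (0, k))
  obtain ⟨y, s, z, hy, hz, rfl⟩ := R.exists_derived_decomposition x
  rw [map_add, map_add]
  refine add_mem (add_mem ?_ (hcartan (a ⊗ₜ[ℂ] s, 0))) ?_
  · exact (currentGenerators A hK).lower_le_generated (tmulCurrent_mem_lower hK hy a)
  · exact (currentGenerators A hK).upper_le_generated (tmulCurrent_mem_upper hK hz a)

end CurrentGenerators

end

end CartanRealization

section EnvelopingModules

variable (k L X : Type*) [CommRing k] [LieRing L] [LieAlgebra k L] [AddCommGroup X] [Module k X]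
  [Module (UniversalEnvelopingAlgebra k L) X] [IsScalarTower k (UniversalEnvelopingAlgebra k L) X]

/-- The representation of a Lie algebra on a module over its enveloping algebra. -/
def envelopingRep : L →ₗ⁅k⁆ Module.End k X :=
  (Algebra.lsmul k k X : UniversalEnvelopingAlgebra k L →ₐ[k] Module.End k X).toLieHom.comp
    (UniversalEnvelopingAlgebra.ι k)

variable {k L X}

theorem envelopingRep_apply (x : L) (w : X) :
    envelopingRep k L X x w = UniversalEnvelopingAlgebra.ι k x • w := rfl

theorem smul_mem_of_envelopingRep_mem {W : Submodule k X}
    (hW : ∀ x : L, ∀ w ∈ W, envelopingRep k L X x w ∈ W) (u : UniversalEnvelopingAlgebra k L)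
    {w : X} (hw : w ∈ W) : u • w ∈ W := by
  obtain ⟨t, rfl⟩ : ∃ t, UniversalEnvelopingAlgebra.mkAlgHom k L t = u :=
    RingCon.mkₐ_surjective _ u
  induction t using TensorAlgebra.induction generalizing w with
  | algebraMap c => rw [AlgHom.commutes, algebraMap_smul]; exact W.smul_mem c hw
  | ι x => exact hW x w hw
  | mul a b ha hb => rw [map_mul, mul_smul]; exact ha (hb hw)
  | add a b ha hb => rw [map_add, add_smul]; exact add_mem (ha hw) (hb hw)

/-- A subspace stable under a Lie algebra, as a submodule over the enveloping algebra. -/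
def stableSubmodule (W : Submodule k X) (hW : ∀ x : L, ∀ w ∈ W, envelopingRep k L X x w ∈ W) :
    Submodule (UniversalEnvelopingAlgebra k L) X where
  __ := W
  smul_mem' u _ hw := smul_mem_of_envelopingRep_mem hW u hw

theorem envelopingRep_mem_map₂ {J : LieIdeal k L} (x : L) {w : X}
    (hw : w ∈ Submodule.map₂ (envelopingRep k L X : L →ₗ[k] Module.End k X) J.toSubmodule ⊤) :
    envelopingRep k L X x w ∈
      Submodule.map₂ (envelopingRep k L X : L →ₗ[k] Module.End k X) J.toSubmodule ⊤ := by
  set W := Submodule.map₂ (envelopingRep k L X : L →ₗ[k] Module.End k X) J.toSubmodule ⊤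
  have hle : W ≤ W.comap (envelopingRep k L X x) := by
    refine Submodule.map₂_le.2 fun y hy w _ => ?_
    rw [Submodule.mem_comap, LieHom.coe_toLinearMap, rep_rep]
    exact add_mem (Submodule.apply_mem_map₂ _ hy Submodule.mem_top)
      (Submodule.apply_mem_map₂ _ (lie_mem_right k L J x y hy) Submodule.mem_top)
  exact hle hw

end EnvelopingModules

namespace ChevalleyGenerators.IsHighestWeight

section EnvelopingModules

variable {k ι A T : Type*} [CommRing k] [CommRing A] [Algebra k A] [AddCommGroup T] [Module k T]
  {D : ChevalleyDatum k ι A T} {L : Type*} [LieRing L] [LieAlgebra k L]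
  {G : ChevalleyGenerators D L} {X : Type*} [AddCommGroup X] [Module k X]
  [Module (UniversalEnvelopingAlgebra k L) X] [IsScalarTower k (UniversalEnvelopingAlgebra k L) X]
  {χ : T → k} {v : X}

theorem map {Y : Type*} [AddCommGroup Y] [Module k Y] [Module (UniversalEnvelopingAlgebra k L) Y]
    [IsScalarTower k (UniversalEnvelopingAlgebra k L) Y]
    (hv : G.IsHighestWeight (envelopingRep k L X) χ v)
    (φ : X →ₗ[UniversalEnvelopingAlgebra k L] Y) :
    G.IsHighestWeight (envelopingRep k L Y) χ (φ v) where
  e_eq_zero i a := by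
    rw [envelopingRep_apply, ← map_smul, ← envelopingRep_apply, hv.e_eq_zero, map_zero]
  t_eq_smul s := by
    rw [envelopingRep_apply, ← map_smul, ← envelopingRep_apply, hv.t_eq_smul,
      φ.map_smul_of_tower]

theorem levels_eq_top (hv : G.IsHighestWeight (envelopingRep k L X) χ v)
    (hG : G.generated = ⊤) (hspan : Submodule.span (UniversalEnvelopingAlgebra k L) {v} = ⊤) :
    G.levels (envelopingRep k L X) v = ⊤ := by
  let N := stableSubmodule (G.levels (envelopingRep k L X) v) fun x _ hw =>
    hv.mem_levels_of_mem_generated (hG ▸ LieSubalgebra.mem_top x) hw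
  have hN : ⊤ ≤ N := hspan ▸ (Submodule.span_singleton_le_iff_mem v N).2 G.mem_levels
  exact eq_top_iff.2 fun x _ => hN (Submodule.mem_top (x := x))

end EnvelopingModules

section MaximalSubmodule

variable {k ι A T : Type*} [Field k] [CharZero k] [CommRing A] [Algebra k A] [AddCommGroup T]
  [Module k T] {D : ChevalleyDatum k ι A T} {L : Type*} [LieRing L] [LieAlgebra k L]
  {G : ChevalleyGenerators D L} {X : Type*} [AddCommGroup X] [Module k X]
  [Module (UniversalEnvelopingAlgebra k L) X] [IsScalarTower k (UniversalEnvelopingAlgebra k L) X]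
  {χ : T → k} {v : X} {h : T}

theorem restrictScalars_le_lowerLevels (hv : G.IsHighestWeight (envelopingRep k L X) χ v)
    (hG : G.generated = ⊤) (hh : D.IsGradingElement h)
    (hspan : Submodule.span (UniversalEnvelopingAlgebra k L) {v} = ⊤)
    {N : Submodule (UniversalEnvelopingAlgebra k L) X} (hN : N ≠ ⊤) :
    N.restrictScalars k ≤ G.lowerLevels (envelopingRep k L X) v := by
  intro w hw
  have hw' : w ∈ Submodule.span k {v} ⊔ G.lowerLevels (envelopingRep k L X) v :=
    G.levels_le_span_sup_lowerLevels (hv.levels_eq_top hG hspan ▸ Submodule.mem_top)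
  obtain ⟨_, hcv, w', hlower, rfl⟩ := Submodule.mem_sup.1 hw'
  obtain ⟨c, rfl⟩ := Submodule.mem_span_singleton.1 hcv
  have hc : c • v ∈ N.restrictScalars k :=
    hv.smul_mem_of_smul_add_mem hh (fun w hw => N.smul_mem _ hw) hlower hw
  obtain rfl | hc0 := eq_or_ne c 0
  · rwa [zero_smul, zero_add]
  · have hvN : v ∈ N := (Submodule.smul_mem_iff (N.restrictScalars k) hc0).1 hc
    exact absurd (top_le_iff.1 (hspan ▸ (Submodule.span_singleton_le_iff_mem v N).2 hvN)) hN

theorem restrictScalars_sSup_le_lowerLevels (hv : G.IsHighestWeight (envelopingRep k L X) χ v)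
    (hG : G.generated = ⊤) (hh : D.IsGradingElement h)
    (hspan : Submodule.span (UniversalEnvelopingAlgebra k L) {v} = ⊤) :
    (sSup {N : Submodule (UniversalEnvelopingAlgebra k L) X | N ≠ ⊤}).restrictScalars k ≤
      G.lowerLevels (envelopingRep k L X) v := by
  rw [Submodule.restrictScalars_sSup]
  refine sSup_le ?_
  rintro _ ⟨N, hN, rfl⟩
  exact hv.restrictScalars_le_lowerLevels hG hh hspan hN

theorem envelopingRep_quotient_eq_zero (hv : G.IsHighestWeight (envelopingRep k L X) χ v)
    (hG : G.generated = ⊤) (hh : D.IsGradingElement h)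
    (hspan : Submodule.span (UniversalEnvelopingAlgebra k L) {v} = ⊤) (hv0 : v ≠ 0)
    {J : LieIdeal k L}
    (hJ : ∀ y ∈ J, envelopingRep k L X y v ∈ G.lowerLevels (envelopingRep k L X) v)
    {y : L} (hy : y ∈ J) :
    envelopingRep k L (X ⧸ sSup {N : Submodule (UniversalEnvelopingAlgebra k L) X | N ≠ ⊤}) y
      = 0 := by
  have hle : Submodule.map₂ (envelopingRep k L X : L →ₗ[k] Module.End k X) J.toSubmodule ⊤ ≤
      G.lowerLevels (envelopingRep k L X) v :=
    Submodule.map₂_le.2 fun y hy w _ => G.mem_lowerLevels_of_forall_lie_f_mem (J := J)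
      (fun y hy i a => lie_mem_left k L J y _ hy) hJ hy
      (hv.levels_eq_top hG hspan ▸ Submodule.mem_top)
  let N := stableSubmodule _ fun (x : L) (_ : X) => envelopingRep_mem_map₂ (J := J) x
  have hN : N ≠ ⊤ := fun htop => hv.notMem_lowerLevels hh hv0
    (hle (htop ▸ Submodule.mem_top : v ∈ N))
  have hNle : N ≤ sSup {N | N ≠ ⊤} := le_sSup hN
  refine LinearMap.ext fun x => ?_
  obtain ⟨w, rfl⟩ := Submodule.mkQ_surjective _ x
  rw [envelopingRep_apply, ← map_smul]
  exact (Submodule.Quotient.mk_eq_zero _).2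
    (hNle (Submodule.apply_mem_map₂ _ hy Submodule.mem_top))

end MaximalSubmodule

end ChevalleyGenerators.IsHighestWeight

namespace CartanRealization

open ChevalleyGenerators

noncomputable section

variable {ι : Type uι} [Fintype ι] {C : Matrix ι ι ℤ}
  {H : Type uH} [AddCommGroup H] [Module ℂ H] {R : CartanRealization C H}
  {K : LieSubalgebra ℂ R.KacMoody} {A : Type uA} [CommRing A] [Algebra ℂ A]
  (ψ : ((A ⊗[ℂ] R.cartanDerived) × K) →ₗ[ℂ] ℂ)

section HighestWeightVectors

/-- The highest weight vector `1 ⊗ 1` of `M(ψ)`. -/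
def vermaVector : Verma ψ := (vermaIdeal ψ).mkQ 1

/-- The image in `V(ψ)` of the highest weight vector of `M(ψ)`. -/
def irrVector : Irr ψ := (maxSubmodule ψ).mkQ (vermaVector ψ)

theorem span_vermaVector : Submodule.span (R.CurrentU A K) {vermaVector ψ} = ⊤ := by
  rw [vermaVector, ← Set.image_singleton, ← Submodule.map_span, Ideal.submodule_span_eq,
    Ideal.span_singleton_one, Submodule.map_top, Submodule.range_mkQ]

theorem span_irrVector : Submodule.span (R.CurrentU A K) {irrVector ψ} = ⊤ := by
  rw [irrVector, ← Set.image_singleton, ← Submodule.map_span, span_vermaVector,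
    Submodule.map_top, Submodule.range_mkQ]

theorem smul_vermaVector_eq_mk (u : R.CurrentU A K) :
    u • vermaVector ψ = (vermaIdeal ψ).mkQ u := by
  rw [vermaVector, ← map_smul, smul_eq_mul, mul_one]

theorem isHighestWeight_vermaVector (hK : R.IsComplement K) :
    (currentGenerators A hK).IsHighestWeight (envelopingRep ℂ (R.Current A K) (Verma ψ))
      (ψ ∘ₗ toCartanPair A hK) (vermaVector ψ) where
  e_eq_zero i a := by
    rw [envelopingRep_apply, smul_vermaVector_eq_mk]
    exact (Submodule.Quotient.mk_eq_zero _).2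
      (Submodule.subset_span (Or.inl ⟨a, _, R.eDerived_mem_nPos i, rfl⟩))
  t_eq_smul s := by
    rw [envelopingRep_apply, ← algebraMap_smul (R.CurrentU A K), smul_vermaVector_eq_mk,
      smul_vermaVector_eq_mk]
    exact (Submodule.Quotient.eq _).2
      (Submodule.subset_span (Or.inr ⟨toCartanPair A hK s, rfl⟩))

theorem isHighestWeight_irrVector (hK : R.IsComplement K) :
    (currentGenerators A hK).IsHighestWeight (envelopingRep ℂ (R.Current A K) (Irr ψ))
      (ψ ∘ₗ toCartanPair A hK) (irrVector ψ) :=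
  (isHighestWeight_vermaVector ψ hK).map (maxSubmodule ψ).mkQ

variable {ψ} in
theorem lift_apply_eq_zero_of_mem_vermaIdeal (hK : R.IsComplement K) {V : Type*} [AddCommGroup V]
    [Module ℂ V] {ρ : R.Current A K →ₗ⁅ℂ⁆ Module.End ℂ V} {v : V}
    (hv : (currentGenerators A hK).IsHighestWeight ρ (ψ ∘ₗ toCartanPair A hK) v)
    {u : R.CurrentU A K} (hu : u ∈ vermaIdeal ψ) :
    UniversalEnvelopingAlgebra.lift ℂ ρ u v = 0 := by
  let Φ := UniversalEnvelopingAlgebra.lift ℂ ρ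
  have hΦ (x : R.Current A K) : Φ (UniversalEnvelopingAlgebra.ι ℂ x) = ρ x :=
    UniversalEnvelopingAlgebra.lift_ι_apply ℂ ρ x
  refine Submodule.span_induction (fun u hu => ?_) (by simp) (fun _ _ _ _ hu hw => ?_)
    (fun u w _ hw => ?_) hu
  · obtain ⟨a, x, hx, rfl⟩ | ⟨t, rfl⟩ := hu
    · exact (LinearMap.congr_fun (hΦ (tmulCurrent K a x)) v).trans
        (hv.eq_zero_of_mem_upper (tmulCurrent_mem_upper hK (R.mem_upper_of_mem_nPos hx) a))
    · obtain ⟨s, rfl⟩ := toCartanPair_surjective hK t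
      change Φ _ v = 0
      rw [map_sub, hΦ, AlgHom.commutes, LinearMap.sub_apply, Module.algebraMap_end_apply]
      exact sub_eq_zero_of_eq (hv.t_eq_smul s)
  · rw [map_add, LinearMap.add_apply, hu, hw, add_zero]
  · rw [smul_eq_mul, map_mul, Module.End.mul_apply, hw, map_zero]

theorem vermaVector_ne_zero (hK : R.IsComplement K) : vermaVector ψ ≠ 0 := by
  obtain ⟨h, hh⟩ := R.exists_isGradingElement_currentDatum (A := A)
  obtain ⟨p, ρ, v, hv, hv0⟩ := exists_isHighestWeight_ne_zero (χ := ψ ∘ₗ toCartanPair A hK)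
    (currentGenerators A hK) (Module.Basis.ofVectorSpace ℂ A) (generated_currentGenerators hK) hh
    fun s hs => by
      have hs0 : toCartanPair A hK s = 0 :=
        currentCartanMap_injective (hs.trans (map_zero _).symm)
      rw [LinearMap.comp_apply, hs0, map_zero]
  intro h0
  have h1 := lift_apply_eq_zero_of_mem_vermaIdeal hK hv ((Submodule.Quotient.mk_eq_zero _).1 h0)
  rw [map_one] at h1
  exact hv0 h1

theorem irrVector_ne_zero (hK : R.IsComplement K) : irrVector ψ ≠ 0 := by
  obtain ⟨h, hh⟩ := R.exists_isGradingElement_currentDatum (A := A)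
  have hv := isHighestWeight_vermaVector ψ hK
  exact fun h0 => hv.notMem_lowerLevels hh (vermaVector_ne_zero ψ hK)
    (hv.restrictScalars_sSup_le_lowerLevels (generated_currentGenerators hK) hh
      (span_vermaVector ψ) ((Submodule.Quotient.mk_eq_zero _).1 h0))

end HighestWeightVectors

section WeightSpaces

theorem t_eq_currentCartan (hK : R.IsComplement K) {h : H} {x : R.cartanDerived} {y : K}
    (hxy : R.toKacMoody h = ((x : R.derived) : R.KacMoody) + (y : R.KacMoody)) :
    (currentGenerators A hK).t (0, h) = R.currentCartan A K (1 ⊗ₜ[ℂ] x, y) := by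
  have hs : split hK h = (x, y) := split_eq hK hxy.symm
  rw [currentGenerators_t, toCartanPair_apply, hs]
  simp

theorem mem_weightSpace_iff (hK : R.IsComplement K) {μ : Module.Dual ℂ R.cartan} {w : Irr ψ} :
    w ∈ weightSpace ψ μ ↔ ∀ h : H, envelopingRep ℂ (R.Current A K) (Irr ψ)
      ((currentGenerators A hK).t (0, h)) w = μ ⟨R.toKacMoody h, h, rfl⟩ • w := by
  constructor
  · intro hw h
    rw [t_eq_currentCartan hK (addMap_split hK h).symm]
    exact hw ⟨R.toKacMoody h, h, rfl⟩ _ _ (addMap_split hK h).symm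
  · rintro hw ⟨_, h, rfl⟩ x y hxy
    have ht := congrArg (fun z => envelopingRep ℂ (R.Current A K) (Irr ψ) z w)
      (t_eq_currentCartan hK hxy)
    exact ht.symm.trans (hw h)

theorem exists_f_mem_weightSpace (hK : R.IsComplement K) (i : ι) :
    ∃ μ : Module.Dual ℂ R.cartan, ∀ a : A,
      envelopingRep ℂ (R.Current A K) (Irr ψ) ((currentGenerators A hK).f i a) (irrVector ψ) ∈
        weightSpace ψ μ := by
  have hv := isHighestWeight_irrVector ψ hK
  obtain ⟨σ, hσ⟩ := LinearMap.exists_rightInverse_of_surjective R.toKacMoody.rangeRestrict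
    R.toKacMoody.range_rangeRestrict
  refine ⟨(ψ ∘ₗ toCartanPair A hK ∘ₗ LinearMap.inr ℂ _ _ - R.root i) ∘ₗ σ, fun a z x y hz => ?_⟩
  have hσz : R.toKacMoody (σ z) = z := congrArg Subtype.val (LinearMap.congr_fun hσ z)
  have ht := congrArg (fun u => envelopingRep ℂ (R.Current A K) (Irr ψ) u
    (envelopingRep ℂ (R.Current A K) (Irr ψ) ((currentGenerators A hK).f i a) (irrVector ψ)))
    (t_eq_currentCartan hK (hσz.trans hz))
  refine ht.symm.trans (hv.t_f_apply (c := R.root i (σ z)) ?_ a)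
  simp [currentDatum_root]

end WeightSpaces

section VanishingIdeal

theorem apply_tmul_eq_zero_of_mem_corootIdeal (hK : R.IsComplement K) {a : A}
    (ha : a ∈ (R.currentDatum A).corootIdeal (ψ ∘ₗ toCartanPair A hK)) (x : R.cartanDerived) :
    ψ (a ⊗ₜ[ℂ] x, 0) = 0 := by
  classical
  have hspan : ⊤ ≤ LinearMap.ker
      (ψ ∘ₗ LinearMap.inl ℂ _ _ ∘ₗ TensorProduct.mk ℂ A R.cartanDerived a) := by
    rw [← R.span_range_corootDerived, Submodule.span_le]
    rintro _ ⟨i, rfl⟩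
    have h := ha i 1
    rw [one_mul] at h
    exact (congrArg ψ (toCartanPair_single hK i a)).symm.trans h
  exact hspan (Submodule.mem_top (x := x))

theorem lie_mem_map₂_tmulCurrent {I : Ideal A} (z : R.Current A K) {y : R.Current A K}
    (hy : y ∈ Submodule.map₂ (tmulCurrent K) (I.restrictScalars ℂ) ⊤) :
    ⁅z, y⁆ ∈ Submodule.map₂ (tmulCurrent K) (I.restrictScalars ℂ) ⊤ := by
  set J := Submodule.map₂ (tmulCurrent K) (I.restrictScalars ℂ) (⊤ : Submodule ℂ R.derived)
  have hmem {a : A} (ha : a ∈ I) (x : R.derived) : tmulCurrent K a x ∈ J :=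
    Submodule.apply_mem_map₂ _ ha Submodule.mem_top
  have hle : J ≤ J.comap (LieAlgebra.ad ℂ (R.Current A K) z) := by
    refine Submodule.map₂_le.2 fun a ha x _ => ?_
    have htop : J.comap (LieAlgebra.ad ℂ (R.Current A K) (tmulCurrent K a x)) = ⊤ := by
      refine eq_top_of_tmulCurrent_mem (fun b y => ?_) fun k => ?_
      · rw [Submodule.mem_comap, LieAlgebra.ad_apply, lie_tmulCurrent]
        exact hmem (I.mul_mem_right b ha) _
      · rw [Submodule.mem_comap, LieAlgebra.ad_apply, ← lie_skew,
          lie_currentCartanMap_tmulCurrent]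
        exact neg_mem (hmem ha _)
    have hz : z ∈ J.comap (LieAlgebra.ad ℂ (R.Current A K) (tmulCurrent K a x)) :=
      htop ▸ Submodule.mem_top
    rw [Submodule.mem_comap, LieAlgebra.ad_apply, ← lie_skew]
    exact neg_mem hz
  exact hle hy

variable (K) in
/-- The ideal `I ⊗ g'` of the current algebra. -/
def idealCurrent (I : Ideal A) : LieIdeal ℂ (R.Current A K) where
  __ := Submodule.map₂ (tmulCurrent K) (I.restrictScalars ℂ) ⊤
  lie_mem {z _} hy := lie_mem_map₂_tmulCurrent z hy

theorem tmulCurrent_mem_idealCurrent {I : Ideal A} {a : A} (ha : a ∈ I) (x : R.derived) :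
    tmulCurrent K a x ∈ idealCurrent K I :=
  Submodule.apply_mem_map₂ _ ha Submodule.mem_top

variable {ψ}

theorem apply_mem_lowerLevels_of_mem_idealCurrent (hK : R.IsComplement K) {V : Type*}
    [AddCommGroup V] [Module ℂ V] {ρ : R.Current A K →ₗ⁅ℂ⁆ Module.End ℂ V} {v : V}
    (hv : (currentGenerators A hK).IsHighestWeight ρ (ψ ∘ₗ toCartanPair A hK) v) {I : Ideal A}
    (hI : ∀ a ∈ I, ∀ x : R.cartanDerived, ψ (a ⊗ₜ[ℂ] x, 0) = 0) {y : R.Current A K}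
    (hy : y ∈ idealCurrent K I) : ρ y v ∈ (currentGenerators A hK).lowerLevels ρ v := by
  have hle : Submodule.map₂ (tmulCurrent K) (I.restrictScalars ℂ) ⊤ ≤
      ((currentGenerators A hK).lowerLevels ρ v).comap
        ((ρ : R.Current A K →ₗ[ℂ] Module.End ℂ V).flip v) := by
    refine Submodule.map₂_le.2 fun a ha x _ => ?_
    obtain ⟨y, s, z, hy, hz, rfl⟩ := R.exists_derived_decomposition x
    obtain ⟨t, ht⟩ := toCartanPair_surjective hK (a ⊗ₜ[ℂ] s, 0)
    have hs : tmulCurrent K a (s : R.derived) = (currentGenerators A hK).t t :=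
      (congrArg (currentCartanMap K A) ht).symm
    rw [map_add, map_add, hs]
    exact hv.apply_mem_lowerLevels (tmulCurrent_mem_lower hK hy a)
      ((congrArg ψ ht).trans (hI a ha s)) (tmulCurrent_mem_upper hK hz a)
  exact hle hy

theorem envelopingRep_irr_eq_zero (hK : R.IsComplement K) {I : Ideal A}
    (hI : ∀ a ∈ I, ∀ x : R.cartanDerived, ψ (a ⊗ₜ[ℂ] x, 0) = 0) {y : R.Current A K}
    (hy : y ∈ idealCurrent K I) : envelopingRep ℂ (R.Current A K) (Irr ψ) y = 0 := by
  obtain ⟨h, hh⟩ := R.exists_isGradingElement_currentDatum (A := A)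
  have hv := isHighestWeight_vermaVector ψ hK
  exact hv.envelopingRep_quotient_eq_zero (generated_currentGenerators hK) hh (span_vermaVector ψ)
    (vermaVector_ne_zero ψ hK)
    (fun _ => apply_mem_lowerLevels_of_mem_idealCurrent hK hv hI) hy

theorem finiteDimensional_weightSpace (hK : R.IsComplement K) {I : Ideal A}
    [FiniteDimensional ℂ (A ⧸ I)]
    (hI : ∀ a ∈ I, ∀ x : R.cartanDerived, ψ (a ⊗ₜ[ℂ] x, 0) = 0) (μ : Module.Dual ℂ R.cartan) :
    FiniteDimensional ℂ (weightSpace ψ μ) := by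
  obtain ⟨h, hh⟩ := R.exists_isGradingElement_currentDatum (A := A)
  have hv := isHighestWeight_irrVector ψ hK
  have hfg (i : ι) : (LinearMap.range ((envelopingRep ℂ (R.Current A K) (Irr ψ) :
      R.Current A K →ₗ[ℂ] Module.End ℂ (Irr ψ)) ∘ₗ (currentGenerators A hK).f i)).FG := by
    refine Submodule.range_fg_iff_ker_cofg.2 (Submodule.CoFG.of_le (S := I.restrictScalars ℂ)
      (fun a ha => envelopingRep_irr_eq_zero hK hI (tmulCurrent_mem_idealCurrent ha _)) ?_)
    exact Module.Finite.equiv (Submodule.Quotient.restrictScalarsEquiv ℂ I).symm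
  have := hv.finiteDimensional_eigenspace hh ((currentGenerators A hK).fg_level hfg)
    (hv.levels_eq_top (generated_currentGenerators hK) (span_irrVector ψ))
    (μ ⟨R.toKacMoody h, h, rfl⟩)
  exact Submodule.finiteDimensional_of_le fun w hw =>
    Module.End.mem_eigenspace_iff.2 ((mem_weightSpace_iff ψ hK).1 hw h)

end VanishingIdeal

end

end CartanRealization

end

theorem lemma2p3_general {ι : Type*} [Fintype ι] {C : Matrix ι ι ℤ}
    {H : Type*} [AddCommGroup H] [Module ℂ H] (R : CartanRealization C H)
    (K : LieSubalgebra ℂ R.KacMoody) (hK : R.IsComplement K)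
    {A : Type*} [CommRing A] [Algebra ℂ A]
    (ψ : ((A ⊗[ℂ] R.cartanDerived) × K) →ₗ[ℂ] ℂ) :
    (∀ μ : Module.Dual ℂ R.cartan, FiniteDimensional ℂ (CartanRealization.weightSpace ψ μ)) ↔
      ∃ I : Ideal A, FiniteDimensional ℂ (A ⧸ I) ∧
        ∀ a ∈ I, ∀ x : R.cartanDerived, ψ (a ⊗ₜ[ℂ] x, 0) = 0 := by
  constructor
  · intro hfin
    choose μ hμ using CartanRealization.exists_f_mem_weightSpace ψ hK
    have hI := (CartanRealization.isHighestWeight_irrVector ψ hK).cofg_corootIdeal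
      (CartanRealization.irrVector_ne_zero ψ hK) hμ
    exact ⟨_, Module.Finite.equiv (Submodule.Quotient.restrictScalarsEquiv ℂ _),
      fun a => CartanRealization.apply_tmul_eq_zero_of_mem_corootIdeal ψ hK⟩
  · rintro ⟨I, hfin, hI⟩ μ
    exact CartanRealization.finiteDimensional_weightSpace hK hI μ

theorem lemma2p3 {ι : Type*} [Fintype ι] {C : Matrix ι ι ℤ}
    (hC : IsGeneralizedCartanMatrix C)
    {H : Type*} [AddCommGroup H] [Module ℂ H] (R : CartanRealization C H)
    (K : LieSubalgebra ℂ R.KacMoody) (hK : R.IsComplement K)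
    {A : Type*} [CommRing A] [Algebra ℂ A] [Algebra.FiniteType ℂ A]
    (ψ : ((A ⊗[ℂ] R.cartanDerived) × K) →ₗ[ℂ] ℂ) :
    (∀ μ : Module.Dual ℂ R.cartan,
        FiniteDimensional ℂ (CartanRealization.weightSpace ψ μ)) ↔
      ∃ I : Ideal A, FiniteDimensional ℂ (A ⧸ I) ∧
        ∀ a ∈ I, ∀ x : R.cartanDerived, ψ (a ⊗ₜ[ℂ] x, 0) = 0 :=
  lemma2p3_general R K hK ψ
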